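/- For a metric $D$ on $X=\{1,\dots,n\}$, $n\ge 2$, let its spread be $\max_{x,y}D(x,y)/\min_{x\ne y}D(x,y)$. For $1\le p\le\infty$, $D$ is a $d$-dimensional $\ell_p$-metric if there is $f:X\to\mathbb R^d$ with $D(x,y)=\|f(x)-f(y)\|_p$ for all $x,y\in X$; such an $f$ realizes $D$. Let $\mathcal D_p(n,d,\Phi)$ be the family of all $d$-dimensional $\ell_p$-metrics on $X$ with spread at most $\Phi$, normalized so that $\min_{x\neq y}D(x,y)=1$. A $b$-bit sketching scheme with distortion $1+\epsilon$ for this family is a pair of algorithms $(\mathsf{Summ},\mathsf{Est})$ that know $p,n,d,\epsilon,\Phi$, such that $\mathsf{Summ}$ maps every $D$ in the family, given by a map $f$ realizing it, to a bitstring $S$ of length $b$, and $\mathsf{Est}$, given only $S$ (and the parameters) and two labels $x,y\in X$, outputs a number with $$D(x,y)\le \mathsf{Est}(S,x,y)\le(1+\epsilon)\,D(x,y).$$ **Theorem.** There are an absolute constant $C$, a polynomial $P$, and a pair of deterministic algorithms $(\mathsf{Summ},\mathsf{Est})$ such that for all $1\le p\le\infty$, $n\ge2$, $d\ge1$, $0<\epsilon\le\frac12$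 and $\Phi\ge2$ there is an integer $$0<b\le C\left(n(d+\log_2 n)\log_2\tfrac1\epsilon+n\log_2\log_2\Phi\right)$$ for which $(\mathsf{Summ},\mathsf{Est})$ is a $b$-bit sketching scheme with distortion $1+\epsilon$ for $\mathcal D_p(n,d,\Phi)$. Both algorithms run in time at most $P(n,d,1/\epsilon,\log_2\Phi)$. Here algorithms are programs for the real RAM: exact real numbers with unit-cost $+,-,\cdot,/$, powers of absolute values and comparisons, without rounding to integers and with no real constants other than natural numbers; unit-cost $+$, truncated $-$ and comparison on natural numbers, which are also used as table indices; output of single bits. -/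

import Mathlib

open scoped ENNReal

noncomputable section

/-! ## The real RAM

Memory consists of countably many two-dimensional tables of natural numbers (indices, counters,
bits), countably many two-dimensional tables of exact real numbers, and an append-only output
tape of bits.  Natural numbers can be added and subtracted (truncated at `0`), and serve as table
indices.  Real numbers can be added, subtracted, multiplied, divided, raised to powers (on absolute
values), and compared.  There is no rounding operation on reals and there are no real constants
other than natural numbers. -/

namespace RealRAM

/-- `nat a i j` and `real a i j` are the cells `(i, j)` of the `a`-th tables. -/
structure State where
  nat : ℕ → ℕ → ℕ → ℕ
  real : ℕ → ℕ → ℕ → ℝ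
  out : List Bool

/-- Overwrite one cell of a family of tables. -/
def write {α : Type} (m : ℕ → ℕ → ℕ → α) (a i j : ℕ) (v : α) : ℕ → ℕ → ℕ → α :=
  fun a' i' j' => if a' = a ∧ i' = i ∧ j' = j then v else m a' i' j'

/-- Natural-number expressions. -/
inductive NExp where
  | lit (k : ℕ)
  | get (a : ℕ) (i j : NExp)
  | add (e₁ e₂ : NExp)
  | sub (e₁ e₂ : NExp)

def NExp.eval (s : State) : NExp → ℕ
  | .lit k => k
  | .get a i j => s.nat a (i.eval s) (j.eval s)
  | .add e₁ e₂ => e₁.eval s + e₂.eval s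
  | .sub e₁ e₂ => e₁.eval s - e₂.eval s

/-- Real expressions. -/
inductive RExp where
  | cast (e : NExp)
  | get (a : ℕ) (i j : NExp)
  | add (e₁ e₂ : RExp)
  | sub (e₁ e₂ : RExp)
  | mul (e₁ e₂ : RExp)
  | div (e₁ e₂ : RExp)
  | pow (e₁ e₂ : RExp)

/-- Division by `0` returns `0`.  The power is that of the absolute value of the base, so that no
oscillating function becomes available. -/
def RExp.eval (s : State) : RExp → ℝ
  | .cast e => (e.eval s : ℝ)
  | .get a i j => s.real a (i.eval s) (j.eval s)
  | .add e₁ e₂ => e₁.eval s + e₂.eval s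
  | .sub e₁ e₂ => e₁.eval s - e₂.eval s
  | .mul e₁ e₂ => e₁.eval s * e₂.eval s
  | .div e₁ e₂ => e₁.eval s / e₂.eval s
  | .pow e₁ e₂ => |e₁.eval s| ^ e₂.eval s

/-- Tests: comparisons of natural numbers and of real numbers, and Boolean combinations. -/
inductive BExp where
  | nlt (e₁ e₂ : NExp)
  | rlt (e₁ e₂ : RExp)
  | not (b : BExp)
  | and (b₁ b₂ : BExp)

def BExp.holds (s : State) : BExp → Prop
  | .nlt e₁ e₂ => e₁.eval s < e₂.eval s
  | .rlt e₁ e₂ => e₁.eval s < e₂.eval s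
  | .not b => ¬ b.holds s
  | .and b₁ b₂ => b₁.holds s ∧ b₂.holds s

/-- Programs. -/
inductive Cmd where
  | skip
  | setNat (a : ℕ) (i j e : NExp)
  | setReal (a : ℕ) (i j : NExp) (e : RExp)
  | emit (bit : Bool)
  | seq (c₁ c₂ : Cmd)
  | ite (b : BExp) (c₁ c₂ : Cmd)
  | loop (b : BExp) (c : Cmd)

/-- `Exec c s s' t`: started in state `s`, the program `c` halts in state `s'` after exactly `t`
steps, where every assignment, every output of a bit and every evaluation of a test is one step.
(The expressions of a fixed program have bounded size, so that counting the single operations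
inside them would change `t` by at most a constant factor that depends only on the program.)
`loop b c` repeats `c` as long as `b` holds. -/
inductive Exec : Cmd → State → State → ℕ → Prop
  | skip (s : State) : Exec .skip s s 1
  | setNat (s : State) (a : ℕ) (i j e : NExp) :
      Exec (.setNat a i j e) s
        { s with nat := write s.nat a (i.eval s) (j.eval s) (e.eval s) } 1
  | setReal (s : State) (a : ℕ) (i j : NExp) (e : RExp) :
      Exec (.setReal a i j e) s
        { s with real := write s.real a (i.eval s) (j.eval s) (e.eval s) } 1
  | emit (s : State) (bit : Bool) : Exec (.emit bit) s { s with out := s.out ++ [bit] } 1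
  | seq {c₁ c₂ : Cmd} {s s' s'' : State} {t₁ t₂ : ℕ} :
      Exec c₁ s s' t₁ → Exec c₂ s' s'' t₂ → Exec (.seq c₁ c₂) s s'' (t₁ + t₂)
  | iteTrue {b : BExp} {c₁ c₂ : Cmd} {s s' : State} {t : ℕ} :
      b.holds s → Exec c₁ s s' t → Exec (.ite b c₁ c₂) s s' (t + 1)
  | iteFalse {b : BExp} {c₁ c₂ : Cmd} {s s' : State} {t : ℕ} :
      ¬ b.holds s → Exec c₂ s s' t → Exec (.ite b c₁ c₂) s s' (t + 1)
  | loopDone {b : BExp} {c : Cmd} {s : State} :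
      ¬ b.holds s → Exec (.loop b c) s s 1
  | loopStep {b : BExp} {c : Cmd} {s s' s'' : State} {t₁ t₂ : ℕ} :
      b.holds s → Exec c s s' t₁ → Exec (.loop b c) s' s'' t₂ →
      Exec (.loop b c) s s'' (t₁ + t₂ + 1)

/-- Programs are deterministic: final state and number of steps are determined by the input. -/
theorem Exec.deterministic {c : Cmd} {s s₁ s₂ : State} {t₁ t₂ : ℕ}
    (h₁ : Exec c s s₁ t₁) (h₂ : Exec c s s₂ t₂) : s₁ = s₂ ∧ t₁ = t₂ := by
  induction h₁ generalizing s₂ t₂ with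
  | skip => cases h₂; exact ⟨rfl, rfl⟩
  | setNat => cases h₂; exact ⟨rfl, rfl⟩
  | setReal => cases h₂; exact ⟨rfl, rfl⟩
  | emit => cases h₂; exact ⟨rfl, rfl⟩
  | seq _ _ ih₁ ih₂ =>
    cases h₂ with
    | seq g₁ g₂ =>
      obtain ⟨rfl, rfl⟩ := ih₁ g₁
      obtain ⟨rfl, rfl⟩ := ih₂ g₂
      exact ⟨rfl, rfl⟩
  | iteTrue hb _ ih =>
    cases h₂ with
    | iteTrue _ g => obtain ⟨rfl, rfl⟩ := ih g; exact ⟨rfl, rfl⟩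
    | iteFalse hb' _ => exact absurd hb hb'
  | iteFalse hb _ ih =>
    cases h₂ with
    | iteTrue hb' _ => exact absurd hb' hb
    | iteFalse _ g => obtain ⟨rfl, rfl⟩ := ih g; exact ⟨rfl, rfl⟩
  | loopDone hb =>
    cases h₂ with
    | loopDone _ => exact ⟨rfl, rfl⟩
    | loopStep hb' _ _ => exact absurd hb' hb
  | loopStep hb _ _ ih₁ ih₂ =>
    cases h₂ with
    | loopDone hb' => exact absurd hb hb'
    | loopStep _ g₁ g₂ =>
      obtain ⟨rfl, rfl⟩ := ih₁ g₁
      obtain ⟨rfl, rfl⟩ := ih₂ g₂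
      exact ⟨rfl, rfl⟩

/-- Started in `s`, the program `c` halts within `T` steps having written the bitstring `S`. -/
def ComputesBits (c : Cmd) (s : State) (S : List Bool) (T : ℝ) : Prop :=
  ∃ (s' : State) (t : ℕ), Exec c s s' t ∧ (t : ℝ) ≤ T ∧ s'.out = S

/-- Started in `s`, the program `c` halts within `T` steps with the number `r` in the cell `(0, 0)`
of the real table `2`. -/
def ComputesReal (c : Cmd) (s : State) (r : ℝ) (T : ℝ) : Prop :=
  ∃ (s' : State) (t : ℕ), Exec c s s' t ∧ (t : ℝ) ≤ T ∧ s'.real 2 0 0 = r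

end RealRAM

/-! ## Metrics and sketches -/

section Metrics

variable {X : Type*}

/-- The smallest distance between two distinct points. -/
def minDist (D : X → X → ℝ) : ℝ := ⨅ q : {q : X × X // q.1 ≠ q.2}, D q.1.1 q.1.2

/-- The diameter. -/
def maxDist (D : X → X → ℝ) : ℝ := ⨆ q : X × X, D q.1 q.2

/-- The spread: the ratio of the diameter to the smallest distance between distinct points. -/
def spread (D : X → X → ℝ) : ℝ := maxDist D / minDist D

/-- `f : X → ℝ^d` realizes `D` as an `ℓ_p`-distance. -/
def IsLpEmbedding {d : ℕ} (p : ℝ≥0∞) (f : X → Fin d → ℝ) (D : X → X → ℝ) : Prop :=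
  ∀ x y, D x y = ‖WithLp.toLp p (f x - f y)‖

end Metrics

/-- The `d`-dimensional `ℓ_p`-metrics on `n` points with spread at most `Φ`, normalized so that the
smallest distance between distinct points is `1`. -/
def lpMetrics (p : ℝ≥0∞) (n d : ℕ) (Φ : ℝ) : Set (Fin n → Fin n → ℝ) :=
  {D | (∃ f : Fin n → Fin d → ℝ, IsLpEmbedding p f D) ∧ minDist D = 1 ∧ spread D ≤ Φ}

/-- Real inputs common to both algorithms, stored in the real table `0`: `ε`, `Φ` and `p`,
where `p = ∞` is represented by the number `0`. -/
def paramReals (p : ℝ≥0∞) (ε Φ : ℝ) (i j : ℕ) : ℝ :=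
  if i = 0 ∧ j = 0 then ε else if i = 0 ∧ j = 1 then Φ else if i = 0 ∧ j = 2 then p.toReal else 0

/-- Initial state of the summary algorithm: `n` and `d` are in the cells `(0, 0)` and `(0, 1)` of
the natural-number table `0`, the numbers `ε`, `Φ`, `p` are in the real table `0`, and the
coordinates `f x j` are in the cells `(x, j)` of the real table `1`; all other cells are `0`. -/
def summInput (p : ℝ≥0∞) {n d : ℕ} (ε Φ : ℝ) (f : Fin n → Fin d → ℝ) : RealRAM.State where
  nat a i j :=
    if a = 0 ∧ i = 0 ∧ j = 0 then n else if a = 0 ∧ i = 0 ∧ j = 1 then d else 0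
  real a i j :=
    if a = 0 then paramReals p ε Φ i j
    else if h : a = 1 ∧ i < n ∧ j < d then f ⟨i, h.2.1⟩ ⟨j, h.2.2⟩ else 0
  out := []

/-- Initial state of the estimation algorithm: `n`, `d`, the labels `x`, `y` and the length of the
bitstring `S` are in the cells `(0, 0)`, …, `(0, 4)` of the natural-number table `0`, the `i`-th bit
of `S` is in the cell `(0, i)` of the natural-number table `1`, and the numbers `ε`, `Φ`, `p` are in
the real table `0`; all other cells are `0`. -/
def estInput (p : ℝ≥0∞) {n : ℕ} (d : ℕ) (ε Φ : ℝ) (S : List Bool) (x y : Fin n) :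
    RealRAM.State where
  nat a i j :=
    if a = 0 ∧ i = 0 then
      (if j = 0 then n else if j = 1 then d else if j = 2 then x else if j = 3 then y
        else if j = 4 then S.length else 0)
    else if a = 1 ∧ i = 0 ∧ S[j]? = some true then 1 else 0
  real a i j := if a = 0 then paramReals p ε Φ i j else 0
  out := []

/-- The pair of programs `(Summ, Est)` is a `b`-bit sketching scheme with distortion `1 + ε` for the
family `lpMetrics p n d Φ`, and both programs make at most `T` steps.  The summary algorithm reads a
metric `D` through an arbitrary embedding `f` that realizes it; the estimation algorithm sees
nothing of `D` but the sketch. -/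
def IsSketchingScheme (Summ Est : RealRAM.Cmd) (p : ℝ≥0∞) (n d : ℕ) (ε Φ : ℝ) (b : ℕ) (T : ℝ) :
    Prop :=
  ∀ D ∈ lpMetrics p n d Φ, ∀ f : Fin n → Fin d → ℝ, IsLpEmbedding p f D →
    ∃ S : List Bool, S.length = b ∧ RealRAM.ComputesBits Summ (summInput p ε Φ f) S T ∧
      ∀ x y : Fin n, ∃ r : ℝ, RealRAM.ComputesReal Est (estInput p d ε Φ S x y) r T ∧
        D x y ≤ r ∧ r ≤ (1 + ε) * D x y

end

/-! The points are attached one by one as in Prim's algorithm: the next point `v` is an unmarked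
point closest to the marked ones, `u` is the marked point that realizes this distance, and its level
`l` satisfies D(u,v) ≤ 2^l < 2 D(u,v). The sketch stores the labels of `v` and `u`, the number `l`
(about log log Φ bits) and a rounded displacement, which the decoder adds to the position `X u` to
obtain `X v`.

The question is which displacement to round. Rounding F v − F u, where `F` are the true coordinates,
lets errors add up along long paths. Rounding F v − X u keeps every error small, but the error
inherited by `u` may come from a level far above `l`, and then the displacement needs too many bits.
The way out is a reference `r`: the last earlier point of level above `l`, or the root. The encoder
rounds (F v − F r) − (X u − X r) with precision δ·2^l. So the errors e = X − F satisfy ‖e v − e r‖ ≤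
δ·2^l, while the displacement has norm at most 2·2^l (`PrimInv.norm_displacement_le`). The decoder
never needs to know `r`.

Levels increase strictly along a chain of references, so errors sum geometrically: along a stretch
of levels at most `l` they differ by at most 4δ·2^l (`LevelwiseClose.norm_sub_le`). For two points,
take the largest level `l` occurring after the first and up to the second. By the cut property of
Prim's algorithm their distance exceeds 2^l / 2, so their errors differ by at most 8δ times the
distance (`PrimInv.abs_norm_sub_norm_le`). With 8δ ≤ ε/8, multiplying the estimate by 1 + ε/4 makes
it one-sided.

For the length, the displacement is scaled by d^(1/p) / 2^l. Its ℓ_1-norm is then at most 2d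
(`sum_abs_mul_le_norm_toLp`), so unary integer parts cost O(d) bits per point in total, and the
binary digits cost O(d log(1/ε)). Unary integer parts and digits found by comparison also make do
without rounding instructions. -/

namespace RealRAM

/-! ## Total correctness with a step bound -/

/-- Started in `s`, the program `c` halts within `T` steps in a state satisfying `Q`. -/
def Wp (c : Cmd) (T : ℕ) (s : State) (Q : State → Prop) : Prop :=
  ∃ (s' : State) (t : ℕ), Exec c s s' t ∧ t ≤ T ∧ Q s'

/-- Overwriting a cell of a natural-number table. -/
def State.wn (s : State) (a i j v : ℕ) : State := { s with nat := write s.nat a i j v }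

/-- Overwriting a cell of a real table. -/
def State.wr (s : State) (a i j : ℕ) (v : ℝ) : State := { s with real := write s.real a i j v }

/-- Appending a bit to the output. -/
def State.push (s : State) (b : Bool) : State := { s with out := s.out ++ [b] }

@[simp] theorem State.wn_nat (s : State) (a i j v a' i' j' : ℕ) :
    (s.wn a i j v).nat a' i' j' = if a' = a ∧ i' = i ∧ j' = j then v else s.nat a' i' j' := rfl
@[simp] theorem State.wn_real (s : State) (a i j v : ℕ) : (s.wn a i j v).real = s.real := rfl
@[simp] theorem State.wn_out (s : State) (a i j v : ℕ) : (s.wn a i j v).out = s.out := rfl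
@[simp] theorem State.wr_real (s : State) (a i j : ℕ) (v : ℝ) (a' i' j' : ℕ) :
    (s.wr a i j v).real a' i' j' = if a' = a ∧ i' = i ∧ j' = j then v else s.real a' i' j' := rfl
@[simp] theorem State.wr_nat (s : State) (a i j : ℕ) (v : ℝ) : (s.wr a i j v).nat = s.nat := rfl
@[simp] theorem State.wr_out (s : State) (a i j : ℕ) (v : ℝ) : (s.wr a i j v).out = s.out := rfl
@[simp] theorem State.push_nat (s : State) (b : Bool) : (s.push b).nat = s.nat := rfl
@[simp] theorem State.push_real (s : State) (b : Bool) : (s.push b).real = s.real := rfl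
@[simp] theorem State.push_out (s : State) (b : Bool) : (s.push b).out = s.out ++ [b] := rfl

attribute [simp] NExp.eval RExp.eval BExp.holds

/-- Does the program write to the natural-number table `a`? -/
def Cmd.writesNat (a : ℕ) : Cmd → Bool
  | .skip => false
  | .setNat a' _ _ _ => a' == a
  | .setReal _ _ _ _ => false
  | .emit _ => false
  | .seq c₁ c₂ => c₁.writesNat a || c₂.writesNat a
  | .ite _ c₁ c₂ => c₁.writesNat a || c₂.writesNat a
  | .loop _ c => c.writesNat a

/-- Does the program write to the real table `a`? -/
def Cmd.writesReal (a : ℕ) : Cmd → Bool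
  | .skip => false
  | .setNat _ _ _ _ => false
  | .setReal a' _ _ _ => a' == a
  | .emit _ => false
  | .seq c₁ c₂ => c₁.writesReal a || c₂.writesReal a
  | .ite _ c₁ c₂ => c₁.writesReal a || c₂.writesReal a
  | .loop _ c => c.writesReal a

/-- Does the program output bits? -/
def Cmd.emits : Cmd → Bool
  | .skip => false
  | .setNat _ _ _ _ => false
  | .setReal _ _ _ _ => false
  | .emit _ => true
  | .seq c₁ c₂ => c₁.emits || c₂.emits
  | .ite _ c₁ c₂ => c₁.emits || c₂.emits
  | .loop _ c => c.emits

/-- `s'` differs from `s` only where `c` may write. -/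
structure Frame (c : Cmd) (s s' : State) : Prop where
  nat : ∀ a, c.writesNat a = false → s'.nat a = s.nat a
  real : ∀ a, c.writesReal a = false → s'.real a = s.real a
  out : c.emits = false → s'.out = s.out

theorem Frame.refl (c : Cmd) (s : State) : Frame c s s := ⟨fun _ _ => rfl, fun _ _ => rfl, fun _ => rfl⟩

theorem Frame.trans {c : Cmd} {s s' s'' : State} (h : Frame c s s') (h' : Frame c s' s'') :
    Frame c s s'' :=
  ⟨fun a ha => (h'.nat a ha).trans (h.nat a ha), fun a ha => (h'.real a ha).trans (h.real a ha),
    fun ha => (h'.out ha).trans (h.out ha)⟩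

theorem Frame.mono {c c' : Cmd} {s s' : State} (h : Frame c s s')
    (h₁ : ∀ a, c'.writesNat a = false → c.writesNat a = false)
    (h₂ : ∀ a, c'.writesReal a = false → c.writesReal a = false)
    (h₃ : c'.emits = false → c.emits = false) : Frame c' s s' :=
  ⟨fun a ha => h.nat a (h₁ a ha), fun a ha => h.real a (h₂ a ha), fun ha => h.out (h₃ ha)⟩

/-- Scalar variables occupy tables of their own, so whether a concrete program preserves one is
decided by computation. The many `rfl` arguments below are such checks, and specifications need only
mention what changes. -/
theorem Exec.frame {c : Cmd} {s s' : State} {t : ℕ} (h : Exec c s s' t) : Frame c s s' := by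
  induction h with
  | skip => exact Frame.refl _ _
  | setNat s a i j e =>
    refine ⟨fun b hb => ?_, fun _ _ => rfl, fun _ => rfl⟩
    have : b ≠ a := by rintro rfl; simp [Cmd.writesNat] at hb
    funext i' j'
    simp [write, this]
  | setReal s a i j e =>
    refine ⟨fun _ _ => rfl, fun b hb => ?_, fun _ => rfl⟩
    have : b ≠ a := by rintro rfl; simp [Cmd.writesReal] at hb
    funext i' j'
    simp [write, this]
  | emit => exact ⟨fun _ _ => rfl, fun _ _ => rfl, fun h => by simp [Cmd.emits] at h⟩
  | seq _ _ ih₁ ih₂ =>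
    exact (ih₁.mono (by simp +contextual [Cmd.writesNat]) (by simp +contextual [Cmd.writesReal])
      (by simp +contextual [Cmd.emits])).trans
      (ih₂.mono (by simp +contextual [Cmd.writesNat]) (by simp +contextual [Cmd.writesReal])
      (by simp +contextual [Cmd.emits]))
  | iteTrue _ _ ih =>
    exact ih.mono (by simp +contextual [Cmd.writesNat]) (by simp +contextual [Cmd.writesReal])
      (by simp +contextual [Cmd.emits])
  | iteFalse _ _ ih =>
    exact ih.mono (by simp +contextual [Cmd.writesNat]) (by simp +contextual [Cmd.writesReal])
      (by simp +contextual [Cmd.emits])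
  | loopDone => exact Frame.refl _ _
  | loopStep _ _ _ ih₁ ih₂ =>
    exact (ih₁.mono (c' := .loop _ _) (fun _ h => h) (fun _ h => h) (fun h => h)).trans ih₂

theorem Wp.mono {c : Cmd} {T T' : ℕ} {s : State} {Q Q' : State → Prop} (h : Wp c T s Q)
    (hT : T ≤ T') (hQ : ∀ s', Frame c s s' → Q s' → Q' s') : Wp c T' s Q' := by
  obtain ⟨s', t, h₁, h₂, h₃⟩ := h
  exact ⟨s', t, h₁, h₂.trans hT, hQ _ h₁.frame h₃⟩

theorem Wp.post {c : Cmd} {T : ℕ} {s : State} {Q Q' : State → Prop} (h : Wp c T s Q)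
    (hQ : ∀ s', Frame c s s' → Q s' → Q' s') : Wp c T s Q' := h.mono le_rfl hQ

theorem Wp.seq {c₁ c₂ : Cmd} {T₁ T₂ : ℕ} {s : State} {Q R : State → Prop} (h₁ : Wp c₁ T₁ s R)
    (h₂ : ∀ s', Frame c₁ s s' → R s' → Wp c₂ T₂ s' Q) : Wp (.seq c₁ c₂) (T₁ + T₂) s Q := by
  obtain ⟨s', t, e, ht, hR⟩ := h₁
  obtain ⟨s'', t', e', ht', hQ⟩ := h₂ s' e.frame hR
  exact ⟨s'', _, .seq e e', by omega, hQ⟩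

theorem Wp.seqLe {c₁ c₂ : Cmd} {T T₁ T₂ : ℕ} {s : State} {Q R : State → Prop}
    (hT : T₁ + T₂ ≤ T) (h₁ : Wp c₁ T₁ s R)
    (h₂ : ∀ s', Frame c₁ s s' → R s' → Wp c₂ T₂ s' Q) : Wp (.seq c₁ c₂) T s Q :=
  (h₁.seq h₂).mono hT fun _ _ h => h

theorem Wp.skip {s : State} {Q : State → Prop} (h : Q s) : Wp .skip 1 s Q :=
  ⟨s, 1, .skip s, le_rfl, h⟩

theorem Wp.setNat {a : ℕ} {i j e : NExp} {s : State} {Q : State → Prop}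
    (h : Q (s.wn a (i.eval s) (j.eval s) (e.eval s))) : Wp (.setNat a i j e) 1 s Q :=
  ⟨_, 1, .setNat s a i j e, le_rfl, h⟩

theorem Wp.setReal {a : ℕ} {i j : NExp} {e : RExp} {s : State} {Q : State → Prop}
    (h : Q (s.wr a (i.eval s) (j.eval s) (e.eval s))) : Wp (.setReal a i j e) 1 s Q :=
  ⟨_, 1, .setReal s a i j e, le_rfl, h⟩

theorem Wp.emit {b : Bool} {s : State} {Q : State → Prop} (h : Q (s.push b)) :
    Wp (.emit b) 1 s Q :=
  ⟨_, 1, .emit s b, le_rfl, h⟩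

theorem Wp.setNat_seq {a : ℕ} {i j e : NExp} {c : Cmd} {T : ℕ} {s : State} {Q : State → Prop}
    (h : Wp c T (s.wn a (i.eval s) (j.eval s) (e.eval s)) Q) :
    Wp (.seq (.setNat a i j e) c) (T + 1) s Q := by
  obtain ⟨s', t, h₁, h₂, h₃⟩ := h
  exact ⟨s', _, .seq (.setNat s a i j e) h₁, by omega, h₃⟩

theorem Wp.setReal_seq {a : ℕ} {i j : NExp} {e : RExp} {c : Cmd} {T : ℕ} {s : State}
    {Q : State → Prop} (h : Wp c T (s.wr a (i.eval s) (j.eval s) (e.eval s)) Q) :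
    Wp (.seq (.setReal a i j e) c) (T + 1) s Q := by
  obtain ⟨s', t, h₁, h₂, h₃⟩ := h
  exact ⟨s', _, .seq (.setReal s a i j e) h₁, by omega, h₃⟩

theorem Wp.emit_seq {b : Bool} {c : Cmd} {T : ℕ} {s : State} {Q : State → Prop}
    (h : Wp c T (s.push b) Q) : Wp (.seq (.emit b) c) (T + 1) s Q := by
  obtain ⟨s', t, h₁, h₂, h₃⟩ := h
  exact ⟨s', _, .seq (.emit s b) h₁, by omega, h₃⟩

theorem Wp.ite {b : BExp} {c₁ c₂ : Cmd} {T : ℕ} {s : State} {Q : State → Prop}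
    (h₁ : b.holds s → Wp c₁ T s Q) (h₂ : ¬ b.holds s → Wp c₂ T s Q) :
    Wp (.ite b c₁ c₂) (T + 1) s Q := by
  by_cases h : b.holds s
  · obtain ⟨s', t, e, ht, hQ⟩ := h₁ h
    exact ⟨s', _, .iteTrue h e, by omega, hQ⟩
  · obtain ⟨s', t, e, ht, hQ⟩ := h₂ h
    exact ⟨s', _, .iteFalse h e, by omega, hQ⟩

/-- A loop with `N ≤ B` iterations and the invariant `I`. -/
theorem Wp.loop {b : BExp} {c : Cmd} {N B T : ℕ} {s : State} (I : ℕ → State → Prop)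
    (hN : N ≤ B) (h0 : I 0 s)
    (hstep : ∀ i < N, ∀ s', Frame c s s' → I i s' → b.holds s' ∧ Wp c T s' (I (i + 1)))
    (hend : ∀ s', Frame c s s' → I N s' → ¬ b.holds s') :
    Wp (.loop b c) (B * (T + 1) + 1) s (fun s' => Frame c s s' ∧ I N s') := by
  have key : ∀ m i, i + m = N → ∀ s', Frame c s s' → I i s' →
      Wp (.loop b c) (m * (T + 1) + 1) s' (fun s'' => Frame c s s'' ∧ I N s'') := by
    intro m
    induction m with
    | zero =>
      intro i hi s' hf hI
      obtain rfl : i = N := by omega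
      exact ⟨s', 1, .loopDone (hend s' hf hI), by omega, hf, hI⟩
    | succ m ih =>
      intro i hi s' hf hI
      obtain ⟨hb, s'', t, e, ht, hI'⟩ := hstep i (by omega) s' hf hI
      obtain ⟨s₃, t', e', ht', hQ⟩ := ih (i + 1) (by omega) s'' (hf.trans e.frame) hI'
      refine ⟨s₃, _, .loopStep hb e e', ?_, hQ⟩
      have : (m + 1) * (T + 1) = m * (T + 1) + (T + 1) := by ring
      omega
  refine (key N 0 (by omega) s (Frame.refl _ _) h0).mono ?_ (fun _ _ h => h)
  gcongr

/-- The scalar variable kept in cell `(0, 0)` of the natural-number table `a`. -/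
abbrev nv (a : ℕ) : NExp := .get a (.lit 0) (.lit 0)

/-- The scalar variable kept in cell `(0, 0)` of the real table `a`. -/
abbrev rv (a : ℕ) : RExp := .get a (.lit 0) (.lit 0)

abbrev setN (a : ℕ) (e : NExp) : Cmd := .setNat a (.lit 0) (.lit 0) e

abbrev setR (a : ℕ) (e : RExp) : Cmd := .setReal a (.lit 0) (.lit 0) e

/-- `for c := start to bound - 1 do body`. -/
def forLoop (c start : ℕ) (bound : NExp) (body : Cmd) : Cmd :=
  .seq (setN c (.lit start))
    (.loop (.nlt (nv c) bound) (.seq body (setN c (.add (nv c) (.lit 1)))))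

/-- The bound is evaluated anew at every test, so `hbound` asks for its value in all states the loop
can reach. The invariant is required after the counter has advanced; the extra 2 per round pays for
that assignment and the test. -/
theorem Wp.forLoop {c start : ℕ} {bound : NExp} {body : Cmd} {N B T : ℕ} {s : State}
    (I : ℕ → State → Prop) (hc : body.writesNat c = false) (hsN : start ≤ N) (hN : N ≤ B)
    (hbound : ∀ s', Frame (forLoop c start bound body) s s' → bound.eval s' = N)
    (h0 : I start (s.wn c 0 0 start))
    (hstep : ∀ i, start ≤ i → i < N → ∀ s', Frame (RealRAM.forLoop c start bound body) s s' →
      s'.nat c 0 0 = i → I i s' → Wp body T s' (fun s'' => I (i + 1) (s''.wn c 0 0 (i + 1)))) :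
    Wp (RealRAM.forLoop c start bound body) (B * (T + 2) + 2) s (I N) := by
  have fr : ∀ s', Frame (.seq body (setN c (.add (nv c) (.lit 1)))) (s.wn c 0 0 start) s' →
      Frame (RealRAM.forLoop c start bound body) s s' := by
    intro s' h
    refine ⟨fun a ha => ?_, fun a ha => ?_, fun ha => ?_⟩
    · rw [h.nat a (by
        simp [Cmd.writesNat, RealRAM.forLoop] at ha ⊢
        exact ⟨ha.2.1, ha.1⟩)]
      have : a ≠ c := by rintro rfl; simp [Cmd.writesNat, RealRAM.forLoop] at ha
      funext i j
      simp [this]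
    · rw [h.real a (by simpa [Cmd.writesReal, RealRAM.forLoop] using ha)]
      rfl
    · rw [h.out (by simpa [Cmd.emits, RealRAM.forLoop] using ha)]
      rfl
  apply Wp.setNat_seq
  refine (Wp.loop (N := N - start) (B := B) (T := T + 1)
    (fun i s' => s'.nat c 0 0 = start + i ∧ I (start + i) s') (by omega) ⟨by simp, by simpa using h0⟩
    ?_ ?_).post ?_
  · intro i hi s' hf hI
    have hf' := fr s' hf
    refine ⟨?_, ?_⟩
    · have := hbound s' hf'
      simp [this, hI.1]
      omega
    · refine Wp.seq (hstep (start + i) (by omega) (by omega) s' hf' hI.1 hI.2) ?_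
      intro s'' hf'' hI''
      apply Wp.setNat
      have e : s''.nat c 0 0 = start + i := by rw [hf''.nat c hc, hI.1]
      simp [e]
      exact ⟨by omega, by simpa [add_assoc] using hI''⟩
  · intro s' hf hI
    have := hbound s' (fr s' hf)
    simp [this, hI.1]
    omega
  · rintro s' - ⟨-, -, h⟩
    simpa [Nat.add_sub_cancel' hsN] using h

end RealRAM

/-! ## Norms -/

section Norms

variable {d : ℕ} (p : ℝ≥0∞)

/-- Turns a coordinatewise rounding error into a norm. For p = ∞ the exponent is 1/0 = 0 and the
factor is 1, so no case distinction is needed. -/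
theorem norm_toLp_le_of_abs_le [Fact (1 ≤ p)] (x : Fin d → ℝ) {c : ℝ} (hc : 0 ≤ c)
    (h : ∀ j, |x j| ≤ c) : ‖WithLp.toLp p x‖ ≤ (d : ℝ) ^ (1 / p.toReal) * c := by
  have h1 : ‖WithLp.toLp p x‖ ≤ ((d : ℝ) ^ (1 / p.toReal)) * ‖x‖ := by
    have := (PiLp.lipschitzWith_toLp p (fun _ : Fin d => ℝ)).dist_le_mul x 0
    simpa [dist_zero_right, ENNReal.toReal_div] using this
  refine h1.trans ?_
  gcongr
  exact (pi_norm_le_iff_of_nonneg hc).2 h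

/-- Hölder's inequality ‖x‖₁ ≤ d^(1−1/p) ‖x‖_p, multiplied by d^(1/p). It bounds the sum of all
unary integer parts of a vector at once. -/
theorem sum_abs_mul_le_norm_toLp [hp : Fact (1 ≤ p)] (x : Fin d → ℝ) :
    (d : ℝ) ^ (1 / p.toReal) * ∑ j, |x j| ≤ d * ‖WithLp.toLp p x‖ := by
  rcases eq_or_ne p ∞ with rfl | hp'
  · simp only [ENNReal.toReal_top, div_zero, Real.rpow_zero, one_mul]
    calc ∑ j, |x j| ≤ ∑ _j : Fin d, ‖WithLp.toLp ∞ x‖ :=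
          Finset.sum_le_sum fun j _ => PiLp.norm_apply_le (WithLp.toLp ∞ x) j
      _ = _ := by simp
  · have hq : 1 ≤ p.toReal := by
      have := ENNReal.toReal_mono hp' hp.out
      simpa using this
    have hq0 : 0 < p.toReal := by linarith
    rw [PiLp.norm_eq_sum hq0]
    set q := p.toReal
    rcases Nat.eq_zero_or_pos d with rfl | hd
    · simp
    have hd' : (0 : ℝ) < d := by exact_mod_cast hd
    have h := Real.rpow_sum_le_const_mul_sum_rpow Finset.univ x hq
    have hS : 0 ≤ ∑ j, |x j| := Finset.sum_nonneg fun _ _ => abs_nonneg _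
    have hS' : 0 ≤ ∑ j, |x j| ^ q := Finset.sum_nonneg fun _ _ => by positivity
    -- The `q`-th root of the power mean inequality `h`.
    have h2 : ∑ j, |x j| ≤ (d : ℝ) ^ ((q - 1) / q) * (∑ j, |x j| ^ q) ^ (1 / q) := by
      have h3 := Real.rpow_le_rpow (by positivity) h (z := 1 / q) (by positivity)
      rw [← Real.rpow_mul hS, mul_one_div_cancel hq0.ne', Real.rpow_one,
        Real.mul_rpow (by positivity) hS', ← Real.rpow_mul (by positivity)] at h3
      simpa [div_eq_mul_inv] using h3
    calc (d : ℝ) ^ (1 / q) * ∑ j, |x j|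
        ≤ (d : ℝ) ^ (1 / q) * ((d : ℝ) ^ ((q - 1) / q) * (∑ j, |x j| ^ q) ^ (1 / q)) := by gcongr
      _ = d * (∑ j, |x j| ^ q) ^ (1 / q) := by
        rw [← mul_assoc, ← Real.rpow_add hd']
        congr 1
        rw [← add_div, add_sub_cancel, div_self hq0.ne', Real.rpow_one]
      _ = _ := by simp

end Norms

/-! ## Propagation of rounding errors along an ordering -/

section Blocks

variable {V : Type*} [SeminormedAddCommGroup V] {N : ℕ} {e : ℕ → V} {lev : ℕ → ℕ} {δ : ℝ}

/-- Each index `j > 0` is compared with the last earlier index of a larger level. -/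
def LevelwiseClose (N : ℕ) (e : ℕ → V) (lev : ℕ → ℕ) (δ : ℝ) : Prop :=
  ∀ j, 1 ≤ j → j < N → ∃ r < j, ‖e j - e r‖ ≤ δ * 2 ^ lev j ∧
    (∀ m, r < m → m < j → lev m ≤ lev j) ∧ (r = 0 ∨ lev j < lev r)

/-- References lead from `a` back to `s` through strictly increasing levels, so the errors form a
geometric sum. The subtracted term 2^(lev a) lets the induction close: lev a < lev r gives 2^(lev a)
− 2^(lev r) ≤ −2^(lev a). -/
theorem LevelwiseClose.norm_sub_start (h : LevelwiseClose N e lev δ) (hδ : 0 ≤ δ) {l s : ℕ}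
    (hs : s = 0 ∨ l < lev s) : ∀ a, s < a → a < N → (∀ m, s < m → m ≤ a → lev m ≤ l) →
      ‖e a - e s‖ ≤ δ * (2 ^ (l + 1) - 2 ^ lev a) := by
  intro a
  induction a using Nat.strong_induction_on with
  | _ a ih =>
    intro hsa haN hm
    obtain ⟨r, hr, h1, h2, h3⟩ := h a (by omega) haN
    have hla : lev a ≤ l := hm a hsa le_rfl
    have hpow : (2 : ℝ) ^ lev a ≤ 2 ^ l := pow_le_pow_right₀ (by norm_num) hla
    -- A reference cannot jump over `s`, whose level exceeds that of `a`.
    have hsr : s ≤ r := by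
      by_contra! hlt
      rcases hs with rfl | hs
      · omega
      · have := h2 s hlt hsa
        omega
    rcases hsr.eq_or_lt with rfl | hsr
    · refine h1.trans ?_
      gcongr
      rw [pow_succ]
      linarith
    · have hr0 : lev a < lev r := by
        rcases h3 with rfl | h3
        · omega
        · exact h3
      have h4 := ih r hr hsr (by omega) fun m hm1 hm2 => hm m hm1 (by omega)
      have h5 : (2 : ℝ) ^ (lev a + 1) ≤ 2 ^ lev r := pow_le_pow_right₀ (by norm_num) hr0
      calc ‖e a - e s‖ ≤ ‖e a - e r‖ + ‖e r - e s‖ := norm_sub_le_norm_sub_add_norm_sub _ _ _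
        _ ≤ δ * 2 ^ lev a + δ * (2 ^ (l + 1) - 2 ^ lev r) := add_le_add h1 h4
        _ = δ * (2 ^ lev a + (2 ^ (l + 1) - 2 ^ lev r)) := by ring
        _ ≤ _ := by
          gcongr
          rw [pow_succ] at h5
          linarith

theorem LevelwiseClose.norm_sub_start_le (h : LevelwiseClose N e lev δ) (hδ : 0 ≤ δ) {l s a : ℕ}
    (hs : s = 0 ∨ l < lev s) (hsa : s ≤ a) (ha : a < N) (hm : ∀ m, s < m → m ≤ a → lev m ≤ l) :
    ‖e a - e s‖ ≤ 2 * δ * 2 ^ l := by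
  rcases hsa.eq_or_lt with rfl | hsa
  · simpa using by positivity
  · refine (h.norm_sub_start hδ hs a hsa ha hm).trans ?_
    have : (0 : ℝ) ≤ 2 ^ lev a := by positivity
    rw [pow_succ]
    nlinarith

/-- The last index up to `a` of level above `l`, or `0`. -/
theorem exists_block_start (lev : ℕ → ℕ) (l a : ℕ) :
    ∃ s ≤ a, (s = 0 ∨ l < lev s) ∧ ∀ m, s < m → m ≤ a → lev m ≤ l := by
  induction a with
  | zero => exact ⟨0, le_rfl, .inl rfl, fun m h1 h2 => by omega⟩
  | succ a ih =>
    by_cases h : l < lev (a + 1)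
    · exact ⟨a + 1, le_rfl, .inr h, fun m h1 h2 => by omega⟩
    · obtain ⟨s, h1, h2, h3⟩ := ih
      refine ⟨s, by omega, h2, fun m hm1 hm2 => ?_⟩
      rcases hm2.eq_or_lt with rfl | hm2
      · omega
      · exact h3 m hm1 (by omega)

/-- Both indices belong to the block that starts at the last index up to `a` of level above `l`;
compare each with that start. -/
theorem LevelwiseClose.norm_sub_le (h : LevelwiseClose N e lev δ) (hδ : 0 ≤ δ) {l a b : ℕ}
    (hab : a ≤ b) (hb : b < N) (hm : ∀ m, a < m → m ≤ b → lev m ≤ l) :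
    ‖e a - e b‖ ≤ 4 * δ * 2 ^ l := by
  obtain ⟨s, h1, h2, h3⟩ := exists_block_start lev l a
  have ha := h.norm_sub_start_le hδ h2 h1 (by omega) h3
  have hb := h.norm_sub_start_le hδ h2 (h1.trans hab) hb fun m hm1 hm2 => by
    rcases le_or_gt m a with h | h
    exacts [h3 m hm1 h, hm m h hm2]
  calc ‖e a - e b‖ ≤ ‖e a - e s‖ + ‖e s - e b‖ := norm_sub_le_norm_sub_add_norm_sub _ _ _
    _ ≤ 2 * δ * 2 ^ l + 2 * δ * 2 ^ l := add_le_add ha (by rwa [norm_sub_rev])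
    _ = _ := by ring

/-- The largest level in (a, b] bounds the difference of the errors from above and, through `hdist`,
the distance from below. -/
theorem LevelwiseClose.norm_sub_le_mul (h : LevelwiseClose N e lev δ) (hδ : 0 ≤ δ)
    {dist : ℕ → ℕ → ℝ}
    (hdist : ∀ m a b, a < m → m ≤ b → b < N → (2 : ℝ) ^ lev m ≤ 2 * dist a b) {a b : ℕ}
    (hab : a < b) (hb : b < N) : ‖e a - e b‖ ≤ 8 * δ * dist a b := by
  obtain ⟨m, hm, hmax⟩ := (Finset.Ioc a b).exists_max_image lev ⟨b, by simp [hab]⟩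
  rw [Finset.mem_Ioc] at hm
  have h1 := h.norm_sub_le hδ hab.le hb fun m' h1 h2 => hmax m' (Finset.mem_Ioc.2 ⟨h1, h2⟩)
  have h2 := hdist m a b hm.1 hm.2 hb
  nlinarith

end Blocks

/-! ## Bit codes for real numbers -/

/-- `ds.getD i false` is the `i`-th binary digit after the point. -/
noncomputable def binaryFraction (ds : List Bool) : ℝ :=
  ∑ i ∈ Finset.range ds.length, if ds.getD i false then (1 / 2 : ℝ) ^ (i + 1) else 0

theorem binaryFraction_append (ds : List Bool) (b : Bool) :
    binaryFraction (ds ++ [b]) =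
      binaryFraction ds + if b then (1 / 2 : ℝ) ^ (ds.length + 1) else 0 := by
  unfold binaryFraction
  rw [List.length_append, List.length_singleton, Finset.sum_range_succ]
  congr 1
  · refine Finset.sum_congr rfl fun i hi => ?_
    rw [List.getD_append _ _ _ _ (Finset.mem_range.1 hi)]
  · simp

/-- The number with the given sign, integer part and binary digits after the point. -/
noncomputable def codeValue (neg : Bool) (q : ℕ) (ds : List Bool) : ℝ :=
  (if neg then -1 else 1) * (q + binaryFraction ds)

/-- Sign, integer part in unary, binary digits after the point. -/
def codeBits (neg : Bool) (q : ℕ) (ds : List Bool) : List Bool :=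
  neg :: (List.replicate q true ++ false :: ds)

/-- `L` is the code of the number `r` with `K` binary digits after the point. -/
def IsCode (K : ℕ) (L : List Bool) (r : ℝ) : Prop :=
  ∃ neg q ds, ds.length = K ∧ L = codeBits neg q ds ∧ r = codeValue neg q ds

/-- `L` is the concatenation of the codes of a sequence of numbers. -/
def IsStream : List (ℕ × ℝ) → List Bool → Prop
  | [], L => L = []
  | x :: xs, L => ∃ L₁ L₂, L = L₁ ++ L₂ ∧ IsCode x.1 L₁ x.2 ∧ IsStream xs L₂

theorem IsStream.append {xs ys : List (ℕ × ℝ)} {L L' : List Bool} (h : IsStream xs L)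
    (h' : IsStream ys L') : IsStream (xs ++ ys) (L ++ L') := by
  induction xs generalizing L with
  | nil => obtain rfl : L = [] := h; simpa using h'
  | cons x xs ih =>
    obtain ⟨L₁, L₂, rfl, h1, h2⟩ := h
    exact ⟨L₁, L₂ ++ L', by simp, h1, ih h2⟩

theorem IsStream.snoc {xs : List (ℕ × ℝ)} {L L' : List Bool} {K : ℕ} {r : ℝ} (h : IsStream xs L)
    (h' : IsCode K L' r) : IsStream (xs ++ [(K, r)]) (L ++ L') :=
  h.append ⟨L', [], by simp, h', rfl⟩

/-! ### Programs that write and read codes of real numbers -/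

namespace RealRAM

theorem Wp.le {c : Cmd} {T T' : ℕ} {s : State} {Q : State → Prop} (h : Wp c T s Q)
    (hT : T ≤ T') : Wp c T' s Q := h.mono hT fun _ _ h => h

/-- Find the least value of the variable `a` that violates `b`. -/
def searchLoop (a : ℕ) (b : BExp) : Cmd :=
  .seq (setN a (.lit 0)) (.loop b (setN a (.add (nv a) (.lit 1))))

theorem Wp.searchLoop {a : ℕ} {b : BExp} {s : State} {N B : ℕ}
    (hb : ∀ m ≤ N, b.holds (s.wn a 0 0 m) ↔ m < N) (hN : N ≤ B) :
    Wp (searchLoop a b) (B * 2 + 2) s (fun s' => s' = s.wn a 0 0 N) := by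
  apply Wp.setNat_seq
  refine (Wp.loop (N := N) (B := B) (T := 1) (fun i s' => s' = s.wn a 0 0 i) hN rfl ?_ ?_).post
    fun _ _ h => h.2
  · rintro i hi s' - rfl
    refine ⟨(hb i hi.le).2 hi, Wp.setNat ?_⟩
    simp only [State.wn, NExp.eval]
    congr 1
    funext a' i' j'
    simp only [write]
    split_ifs <;> simp_all
  · rintro s' - rfl
    simpa using (hb N le_rfl).not

/-- Output a bit and count it in the variable `4`. -/
def emitBit (b : Bool) : Cmd := .seq (.emit b) (setN 4 (.add (nv 4) (.lit 1)))

theorem Wp.emitBit {b : Bool} {s : State} {Q : State → Prop}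
    (h : Q ((s.push b).wn 4 0 0 (s.nat 4 0 0 + 1))) : Wp (emitBit b) 2 s Q :=
  Wp.emit_seq (Wp.setNat h)

theorem Wp.emitBit_seq {b : Bool} {c : Cmd} {T : ℕ} {s : State} {Q : State → Prop}
    (h : Wp c T ((s.push b).wn 4 0 0 (s.nat 4 0 0 + 1)) Q) :
    Wp (.seq (RealRAM.emitBit b) c) (T + 2) s Q := by
  rw [add_comm]
  refine Wp.seq (R := fun s' => s' = (s.push b).wn 4 0 0 (s.nat 4 0 0 + 1)) (Wp.emitBit rfl) ?_
  rintro _ - rfl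
  exact h

/-- Output the code, with as many binary digits as the variable `2` says, of a number close to
the real variable `3`; that number is left in the real variable `5`. -/
def encode : Cmd :=
  .seq (.ite (.rlt (rv 3) (.cast (.lit 0)))
    (.seq (emitBit true) (.seq (setR 4 (.sub (.cast (.lit 0)) (rv 3)))
      (setR 7 (.sub (.cast (.lit 0)) (.cast (.lit 1))))))
    (.seq (emitBit false) (.seq (setR 4 (rv 3)) (setR 7 (.cast (.lit 1)))))) <|
  .seq (setR 5 (.cast (.lit 0))) <|
  .seq (.loop (.not (.rlt (rv 4) (.cast (.lit 1))))
    (.seq (emitBit true) (.seq (setR 4 (.sub (rv 4) (.cast (.lit 1))))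
      (setR 5 (.add (rv 5) (.cast (.lit 1))))))) <|
  .seq (emitBit false) <|
  .seq (setR 6 (.cast (.lit 1))) <|
  .seq (forLoop 3 0 (nv 2)
    (.seq (setR 6 (.div (rv 6) (.cast (.lit 2))))
      (.ite (.rlt (rv 4) (rv 6)) (emitBit false)
        (.seq (emitBit true) (.seq (setR 4 (.sub (rv 4) (rv 6)))
          (setR 5 (.add (rv 5) (rv 6)))))))) <|
  setR 5 (.mul (rv 7) (rv 5))

/-- The integer part is found by repeated subtraction of 1, so both time and output grow with |y|.
Truncation is towards 0; the resulting |r| ≤ |y| is what makes natural numbers decodable later. -/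
theorem wp_encode {s : State} {y : ℝ} {K B : ℕ} (hy : s.real 3 0 0 = y) (hK : s.nat 2 0 0 = K)
    (hcnt : s.nat 4 0 0 = s.out.length) (hKB : K ≤ B) (hyB : |y| ≤ B) :
    Wp encode (13 * B + 20) s (fun s' => s'.nat 4 0 0 = s'.out.length ∧
      ∃ L r, IsCode K L r ∧ s'.out = s.out ++ L ∧ s'.real 5 0 0 = r ∧ |r| ≤ |y| ∧
        |r - y| < (1 / 2) ^ K ∧ (L.length : ℝ) ≤ |y| + 2 + K) := by
  set neg : Bool := decide (y < 0) with hneg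
  set sg : ℝ := if neg then -1 else 1 with hsg
  set q := ⌊|y|⌋₊ with hq
  have hq1 : (q : ℝ) ≤ |y| := Nat.floor_le (abs_nonneg y)
  have hq2 : |y| < q + 1 := Nat.lt_floor_add_one _
  have hsgy : sg * |y| = y := by
    by_cases h : y < 0
    · simp [hsg, hneg, h, abs_of_neg h]
    · simp [hsg, hneg, h, abs_of_nonneg (not_lt.1 h)]
  have hsga : |sg| = 1 := by
    rw [hsg]; split_ifs <;> simp
  unfold encode
  refine Wp.seqLe (T₁ := 5) (T₂ := 13 * B + 15) (by omega) (R := fun s' => s'.nat 4 0 0 = s'.out.length ∧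
    s'.out = s.out ++ [neg] ∧ s'.real 4 0 0 = |y| ∧ s'.real 7 0 0 = sg) ?_ ?_
  · refine Wp.ite (fun h => ?_) (fun h => ?_)
    · have h : y < 0 := by simpa [hy] using h
      exact Wp.emitBit_seq (Wp.setReal_seq (Wp.setReal
        (by simp [hcnt, hy, hneg, hsg, h, abs_of_neg h])))
    · have h : ¬ y < 0 := by simpa [hy] using h
      exact Wp.emitBit_seq (Wp.setReal_seq (Wp.setReal
        (by simp [hcnt, hy, hneg, hsg, h, abs_of_nonneg (not_lt.1 h)])))
  rintro s₁ f₁ ⟨c₁, o₁, a₁, g₁⟩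
  apply Wp.setReal_seq
  refine Wp.seqLe (T₁ := B * (4 + 1) + 1) (T₂ := 8 * B + 13) (by omega) (R := fun s' => s'.nat 4 0 0 = s'.out.length ∧
    s'.out = s.out ++ neg :: List.replicate q true ∧ s'.real 4 0 0 = |y| - q ∧
    s'.real 5 0 0 = q) ((Wp.loop (N := q) (B := B) (T := 4)
      (fun i s' => s'.nat 4 0 0 = s'.out.length ∧
    s'.out = s.out ++ neg :: List.replicate i true ∧ s'.real 4 0 0 = |y| - i ∧
    s'.real 5 0 0 = i) ?_ ?_ ?_ ?_).post fun _ _ h => h.2) ?_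
  · exact_mod_cast hq1.trans hyB
  · simp [c₁, o₁, a₁]
  · rintro i hi s' - ⟨c, o, a, g⟩
    have hi' : (i : ℝ) + 1 ≤ q := by exact_mod_cast hi
    refine ⟨by simp [a]; linarith, ?_⟩
    refine Wp.emitBit_seq (Wp.setReal_seq (Wp.setReal ?_))
    simp [c, o, a, g, List.replicate_succ', sub_sub]
    omega
  · rintro s' - ⟨c, o, a, g⟩
    simp [a]
    linarith
  rintro s₂ f₂ ⟨c₂, o₂, a₂, g₂⟩
  apply Wp.emitBit_seq
  apply Wp.setReal_seq
  have hK₂ : s₂.nat 2 0 0 = K := by rw [f₂.nat 2 rfl]; simp [f₁.nat 2 rfl, hK]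
  have hs₂ : s₂.real 7 0 0 = sg := by rw [f₂.real 7 rfl]; simp [g₁]
  -- The real variable 4 holds the part of |y| not yet written, which after `i` digits lies in [0,
  -- 2^(−i)).
  refine Wp.seqLe (T₁ := B * (6 + 2) + 2) (T₂ := 1) (by omega) (Wp.forLoop (N := K) (B := B) (T := 6) (fun i s' => s'.nat 4 0 0 = s'.out.length ∧
    ∃ ds : List Bool, ds.length = i ∧ s'.out = s.out ++ codeBits neg q ds ∧
      s'.real 4 0 0 = |y| - q - binaryFraction ds ∧ s'.real 5 0 0 = q + binaryFraction ds ∧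
      s'.real 6 0 0 = (1 / 2) ^ i ∧ 0 ≤ s'.real 4 0 0 ∧ s'.real 4 0 0 < (1 / 2) ^ i)
      rfl (Nat.zero_le _) hKB ?_ ?_ ?_) ?_
  · intro s' f
    simpa [hK₂] using congrFun (congrFun (f.nat 2 rfl) 0) 0
  · refine ⟨by simp [c₂], [], rfl, by simp [o₂, codeBits], ?_⟩
    simp [a₂, g₂, binaryFraction]
    exact ⟨hq1, by linarith⟩
  · rintro i - hi s' f hc ⟨c, ds, hds, o, a, g, m, p1, p2⟩
    have hw : (1 / 2 : ℝ) ^ (i + 1) = (1 / 2) ^ i / 2 := by rw [pow_succ]; ring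
    generalize (1 / 2 : ℝ) ^ i = ω at m p2 hw
    rw [a] at p1 p2
    apply Wp.setReal_seq
    refine Wp.ite (fun h => (Wp.emitBit ?_).le (T' := 4) (by norm_num)) (fun h => ?_)
    · simp [m, a] at h
      refine ⟨by simp [c], ds ++ [false], by simp [hds], by simp [o, codeBits], ?_⟩
      rw [binaryFraction_append, hw]
      simp [a, g, m]
      exact ⟨by linarith, h⟩
    · simp [m, a] at h
      refine Wp.emitBit_seq (Wp.setReal_seq (Wp.setReal ?_))
      refine ⟨by simp [c], ds ++ [true], by simp [hds], by simp [o, codeBits], ?_⟩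
      rw [binaryFraction_append, hds, hw]
      simp [a, g, m]
      exact ⟨by ring, by ring, by linarith, by linarith⟩
  rintro s₃ f₃ ⟨c₃, ds, hds, o₃, a₃, g₃, m₃, p1, p2⟩
  have hs₃ : s₃.real 7 0 0 = sg := by
    rw [f₃.real 7 rfl]; simp [hs₂]
  apply Wp.setReal
  refine ⟨by simp [c₃], codeBits neg q ds, _, ⟨neg, q, ds, hds, rfl, rfl⟩, by simp [o₃],
    by simp [hs₃, g₃, codeValue, hsg], ?_, ?_, ?_⟩
  · change |sg * (q + binaryFraction ds)| ≤ _
    rw [abs_mul, hsga, one_mul, abs_le]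
    have : 0 ≤ binaryFraction ds := Finset.sum_nonneg fun i _ => by split_ifs <;> positivity
    rw [a₃] at p1
    constructor <;> linarith [Nat.cast_nonneg (α := ℝ) q]
  · change |sg * (q + binaryFraction ds) - y| < _
    have : sg * (q + binaryFraction ds) - y = sg * -(s₃.real 4 0 0) := by
      rw [a₃]; linear_combination hsgy
    rw [this, abs_mul, hsga, abs_neg, abs_of_nonneg p1, one_mul]
    exact p2
  · simp [codeBits, hds]
    linarith

/-- Does the tape, natural-number table `1`, have the bit `1` at the position `4`? -/
def bitTest : BExp := .nlt (.lit 0) (.get 1 (.lit 0) (nv 4))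

/-- Advance the reading position. -/
def advance : Cmd := setN 4 (.add (nv 4) (.lit 1))

/-- Read the code of a number, with as many binary digits as the variable `2` says, and leave that
number in the real variable `5`. -/
def decode : Cmd :=
  .seq (.ite bitTest (setR 7 (.sub (.cast (.lit 0)) (.cast (.lit 1)))) (setR 7 (.cast (.lit 1)))) <|
  .seq advance <|
  .seq (setR 5 (.cast (.lit 0))) <|
  .seq (.loop bitTest (.seq (setR 5 (.add (rv 5) (.cast (.lit 1)))) advance)) <|
  .seq advance <|
  .seq (setR 6 (.cast (.lit 1))) <|
  .seq (forLoop 3 0 (nv 2)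
    (.seq (setR 6 (.div (rv 6) (.cast (.lit 2))))
      (.seq (.ite bitTest (setR 5 (.add (rv 5) (rv 6))) .skip) advance))) <|
  setR 5 (.mul (rv 7) (rv 5))

/-- The tape contains the bits `S`. -/
def Tape (S : List Bool) (s : State) : Prop :=
  ∀ i, s.nat 1 0 i = if S[i]? = some true then 1 else 0

theorem Tape.holds {S : List Bool} {s : State} (h : Tape S s) :
    bitTest.holds s ↔ S[s.nat 4 0 0]? = some true := by
  simp only [bitTest, BExp.holds, NExp.eval, h (s.nat 4 0 0)]
  split_ifs with h <;> simp [h]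

theorem Tape.congr {S : List Bool} {s s' : State} (h : Tape S s) (hs : s'.nat 1 = s.nat 1) :
    Tape S s' := fun i => by rw [hs]; exact h i

/-- Codes are self-delimiting once `K` is known, so the reading position ends exactly where `rest`
begins. -/
theorem wp_decode {s : State} {S L rest : List Bool} {r : ℝ} {K B : ℕ} (hS : Tape S s)
    (hK : s.nat 2 0 0 = K) (hL : IsCode K L r) (hdrop : S.drop (s.nat 4 0 0) = L ++ rest)
    (hB : L.length ≤ B) :
    Wp decode (9 * B + 20) s (fun s' => S.drop (s'.nat 4 0 0) = rest ∧ s'.real 5 0 0 = r) := by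
  obtain ⟨neg, q, ds, hds, rfl, rfl⟩ := hL
  set pos := s.nat 4 0 0 with hpos
  have hget : ∀ i, S[pos + i]? = (codeBits neg q ds ++ rest)[i]? := by
    intro i; rw [← hdrop, List.getElem?_drop]
  -- Layout of a code: the sign, `q` ones, a zero that ends the unary part, then the digits.
  have g0 : S[pos]? = some neg := by simpa [codeBits] using hget 0
  have g1 : ∀ i < q, S[pos + 1 + i]? = some true := by
    intro i hi
    rw [add_assoc, hget]
    simp [codeBits, add_comm 1 i, List.getElem?_append, hi]
  have g2 : S[pos + 1 + q]? = some false := by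
    rw [add_assoc, hget]
    simp [codeBits, add_comm 1 q]
  have g3 : ∀ i < ds.length, S[pos + 1 + q + 1 + i]? = some (ds.getD i false) := by
    intro i hi
    rw [show pos + 1 + q + 1 + i = pos + ((q + 1 + i) + 1) by ring, hget]
    simp only [codeBits, List.cons_append, List.getElem?_cons_succ, List.append_assoc]
    rw [List.getElem?_append_right (by simp; omega)]
    simp [add_assoc, add_comm 1 i, hi, List.getElem?_append_left hi]
  simp [codeBits, hds] at hB
  have hKB : K ≤ B := by omega
  unfold decode
  refine Wp.seqLe (T₁ := 2) (T₂ := 9 * B + 18) (by omega) (R := fun s' => s'.real 7 0 0 = if neg then -1 else 1) ?_ ?_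
  · refine Wp.ite (fun h => Wp.setReal ?_) (fun h => Wp.setReal ?_)
    · rw [hS.holds, ← hpos, g0] at h
      simp_all
    · rw [hS.holds, ← hpos, g0] at h
      simp_all
  rintro s₁ f₁ h₁
  have hS₁ : Tape S s₁ := hS.congr (f₁.nat 1 rfl)
  have p₁ : s₁.nat 4 0 0 = pos := by rw [f₁.nat 4 rfl]
  apply Wp.setNat_seq
  apply Wp.setReal_seq
  refine Wp.seqLe (T₁ := B * (2 + 1) + 1) (T₂ := 6 * B + 10) (by omega) ((Wp.loop (N := q) (B := B) (T := 2) (fun i s' => s'.nat 4 0 0 = pos + 1 + i ∧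
    s'.real 5 0 0 = i) (by omega) ?_ ?_ ?_).post fun _ _ h => h.2) ?_
  · simp [p₁]
  · rintro i hi s' f ⟨h1, h2⟩
    refine ⟨?_, ?_⟩
    · rw [Tape.holds (hS₁.congr (by rw [f.nat 1 rfl]; rfl)), h1, g1 i hi]
    · apply Wp.setReal_seq
      apply Wp.setNat
      simp [h1, h2, add_assoc]
  · rintro s' f ⟨h1, h2⟩
    rw [Tape.holds (hS₁.congr (by rw [f.nat 1 rfl]; rfl)), h1, g2]
    simp
  rintro s₂ f₂ ⟨p₂, r₂⟩
  have hS₂ : Tape S s₂ := hS₁.congr (by rw [f₂.nat 1 rfl]; rfl)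
  have hK₂ : s₂.nat 2 0 0 = K := by rw [f₂.nat 2 rfl]; simp [f₁.nat 2 rfl, hK]
  have hs₂ : s₂.real 7 0 0 = if neg then -1 else 1 := by rw [f₂.real 7 rfl]; simp [h₁]
  apply Wp.setNat_seq
  apply Wp.setReal_seq
  refine Wp.seqLe (T₁ := B * (4 + 2) + 2) (T₂ := 1) (by omega) (Wp.forLoop (N := K) (B := B) (T := 4) (fun i s' =>
    s'.nat 4 0 0 = pos + 1 + q + 1 + i ∧ s'.real 6 0 0 = (1 / 2) ^ i ∧
    s'.real 5 0 0 = q + binaryFraction (ds.take i))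
      rfl (Nat.zero_le _) hKB ?_ ?_ ?_) ?_
  · intro s' f
    simpa [hK₂] using congrFun (congrFun (f.nat 2 rfl) 0) 0
  · simp [p₂, r₂, binaryFraction]
  · rintro i - hi s' f hc ⟨h1, h2, h3⟩
    have hS' : Tape S s' := hS₂.congr (by rw [f.nat 1 rfl]; rfl)
    have hi' : i < ds.length := by omega
    have htake : ds.take (i + 1) = ds.take i ++ [ds.getD i false] := by
      rw [List.take_add_one]; simp [hi']
    apply Wp.setReal_seq
    refine Wp.seq (T₁ := 2) (T₂ := 1) (R := fun s'' =>
      s''.real 5 0 0 = q + binaryFraction (ds.take (i + 1))) ?_ ?_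
    · have hh := (hS'.congr (s' := (s'.wr 6 0 0 ((s'.real 6 0 0) / 2))) rfl).holds
      rw [State.wr_nat, h1, g3 i hi'] at hh
      refine Wp.ite (fun h => Wp.setReal ?_) (fun h => Wp.skip ?_)
      · have := hh.1 (by simpa using h)
        simp only [Option.some.injEq] at this
        rw [htake, binaryFraction_append, this]
        simp [h2, h3, hi'.le, pow_succ]
        ring
      · have := mt hh.2 (by simpa using h)
        simp only [Option.some.injEq] at this
        rw [htake, binaryFraction_append, if_neg this]
        simp [h3]
    · rintro s'' f'' h5
      apply Wp.setNat
      have e1 : s''.nat 4 0 0 = pos + 1 + q + 1 + i := by rw [f''.nat 4 rfl]; simp [h1]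
      have e2 : s''.real 6 0 0 = (1 / 2) ^ (i + 1) := by
        rw [f''.real 6 rfl]; simp [h2, pow_succ]; ring
      simp [e1, e2, h5]
      ring
  rintro s₃ f₃ ⟨p₃, m₃, r₃⟩
  have hs₃ : s₃.real 7 0 0 = if neg then -1 else 1 := by rw [f₃.real 7 rfl]; simp [hs₂]
  apply Wp.setReal
  refine ⟨?_, ?_⟩
  · simp only [State.wr_nat, p₃]
    rw [show pos + 1 + q + 1 + K = pos + (codeBits neg q ds).length by
      simp [codeBits, hds]; ring, ← List.drop_drop, hdrop]
    simp
  · simp [hs₃, r₃, ← hds, codeValue]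

/-! ### Computing an ℓ_p-norm -/

/-- Leave in the real variable `12` the `ℓ_p`-norm of the vector whose coordinate with the index
in variable `19` is `e`. -/
def normOf (e : RExp) : Cmd :=
  .ite (.rlt (.cast (.lit 0)) (.get 0 (.lit 0) (.lit 2)))
    (.seq (setR 12 (.cast (.lit 0))) <|
      .seq (forLoop 19 0 (.get 0 (.lit 0) (.lit 1))
        (setR 12 (.add (rv 12) (.pow e (.get 0 (.lit 0) (.lit 2)))))) <|
      setR 12 (.pow (rv 12) (.div (.cast (.lit 1)) (.get 0 (.lit 0) (.lit 2)))))
    (.seq (setR 12 (.cast (.lit 0))) <|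
      forLoop 19 0 (.get 0 (.lit 0) (.lit 1))
        (.seq (setR 13 (.pow e (.cast (.lit 1))))
          (.ite (.rlt (rv 12) (rv 13)) (setR 12 (rv 13)) .skip)))

theorem wp_normOf {e : RExp} {s : State} {p : ℝ≥0∞} {d B : ℕ} (hp : 1 ≤ p)
    (hd : s.nat 0 0 1 = d) (hps : s.real 0 0 2 = p.toReal) (x : Fin d → ℝ)
    (he : ∀ s', Frame (normOf e) s s' → ∀ j : Fin d, s'.nat 19 0 0 = j → e.eval s' = x j)
    (hB : d ≤ B) :
    Wp (normOf e) (5 * B + 10) s (fun s' => s'.real 12 0 0 = ‖WithLp.toLp p x‖) := by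
  refine Wp.ite (T := 5 * B + 9) (fun h => ?_) (fun h => ?_)
  · have h : 0 < p.toReal := by simpa [hps] using h
    apply Wp.setReal_seq
    refine Wp.seqLe (T₁ := B * (1 + 2) + 2) (T₂ := 1) (by omega) (Wp.forLoop (N := d) (B := B) (T := 1) (fun i s' =>
      s'.real 12 0 0 = ∑ j : Fin d, if j.1 < i then |x j| ^ p.toReal else 0)
      rfl (Nat.zero_le _) hB ?_ ?_ ?_) ?_
    · intro s' f
      simpa [hd] using congrFun (congrFun (f.nat 0 rfl) 0) 1
    · simp
    · rintro i - hi s' f hc h1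
      apply Wp.setReal
      have f' : Frame (normOf e) s s' := by
        refine ⟨fun a ha => ?_, fun a ha => ?_, fun _ => ?_⟩
        · exact f.nat a (by simpa [normOf, forLoop, Cmd.writesNat] using ha)
        · rw [f.real a (by
            simp [normOf, forLoop, Cmd.writesReal] at ha ⊢; tauto)]
          have : a ≠ 12 := by rintro rfl; simp [normOf, forLoop, Cmd.writesReal] at ha
          funext i j
          simp [this]
        · exact f.out rfl
      have e1 := he s' f' ⟨i, hi⟩ hc
      have e2 : s'.real 0 0 2 = p.toReal := by rw [f.real 0 rfl]; simp [hps]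
      simp only [RExp.eval, NExp.eval, State.wn_real, State.wr_real, e1, e2, h1]
      simp only [and_self, if_true]
      rw [← Finset.sum_erase_add _ _ (Finset.mem_univ (⟨i, hi⟩ : Fin d)),
        ← Finset.sum_erase_add
            (f := fun j : Fin d => if j.1 < i + 1 then |x j| ^ p.toReal else 0) _
            (Finset.mem_univ (⟨i, hi⟩ : Fin d))]
      simp only [lt_self_iff_false, if_false, add_zero, lt_add_iff_pos_right, zero_lt_one,
        if_true]
      congr 1
      refine Finset.sum_congr rfl fun j hj => ?_
      have : j.1 ≠ i := fun hji => (Finset.mem_erase.1 hj).1 (Fin.ext hji)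
      have : j.1 < i + 1 ↔ j.1 < i := by omega
      simp [this]
    rintro s₁ f₁ h₁
    apply Wp.setReal
    have e2 : s₁.real 0 0 2 = p.toReal := by rw [f₁.real 0 rfl]; simp [hps]
    have hS : 0 ≤ ∑ j : Fin d, |x j| ^ p.toReal := Finset.sum_nonneg fun _ _ => by positivity
    simp only [Fin.is_lt, if_true] at h₁
    rw [PiLp.norm_eq_sum h]
    simp [h₁, e2, abs_of_nonneg hS]
  -- The exponent is stored as `p.toReal`, which is 0 only for p = ∞ once p = 0 is excluded.
  · have h : p = ∞ := by
      have h : p.toReal ≤ 0 := by simpa [hps] using h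
      have := (ENNReal.toReal_eq_zero_iff p).1 (le_antisymm h ENNReal.toReal_nonneg)
      rcases this with rfl | h
      · simp at hp
      · exact h
    subst h
    apply Wp.setReal_seq
    -- The running maximum is described as a least upper bound; the inserted 0 is its initial value
    -- and keeps the set nonempty.
    refine (Wp.forLoop (N := d) (B := B) (T := 3) (fun i s' =>
        IsLUB (insert 0 {a | ∃ j : Fin d, j.1 < i ∧ a = |x j|}) (s'.real 12 0 0))
        rfl (Nat.zero_le _) hB ?_ ?_ ?_).mono (by omega) ?_
    · intro s' f
      simpa [hd] using congrFun (congrFun (f.nat 0 rfl) 0) 1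
    · simp
    · rintro i - hi s' f hc h1
      have f' : Frame (normOf e) s s' := by
        refine ⟨fun a ha => ?_, fun a ha => ?_, fun _ => ?_⟩
        · exact f.nat a (by simpa [normOf, forLoop, Cmd.writesNat] using ha)
        · rw [f.real a (by
            simp [normOf, forLoop, Cmd.writesReal] at ha ⊢; tauto)]
          have : a ≠ 12 := by rintro rfl; simp [normOf, forLoop, Cmd.writesReal] at ha
          funext i j
          simp [this]
        · exact f.out rfl
      have e1 := he s' f' ⟨i, hi⟩ hc
      have hset : insert (0 : ℝ) {a | ∃ j : Fin d, j.1 < i + 1 ∧ a = |x j|} =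
          insert |x ⟨i, hi⟩| (insert 0 {a | ∃ j : Fin d, j.1 < i ∧ a = |x j|}) := by
        rw [Set.insert_comm]
        congr 1
        ext a
        simp only [Set.mem_ofPred_eq, Set.mem_insert_iff]
        constructor
        · rintro ⟨j, hj, rfl⟩
          rcases Nat.lt_succ_iff_lt_or_eq.1 hj with hj | hj
          · exact .inr ⟨j, hj, rfl⟩
          · exact .inl (by rw [show j = ⟨i, hi⟩ from Fin.ext hj])
        · rintro (rfl | ⟨j, hj, rfl⟩)
          · exact ⟨⟨i, hi⟩, by simp, rfl⟩
          · exact ⟨j, by omega, rfl⟩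
      have h2 := h1.insert |x ⟨i, hi⟩|
      rw [← hset] at h2
      apply Wp.setReal_seq
      refine Wp.ite (fun h => Wp.setReal ?_) (fun h => Wp.skip ?_)
      · simp [e1] at h
        simpa [e1, max_eq_left h.le, h.le] using h2
      · simp [e1] at h
        simpa [max_eq_right h] using h2
    · rintro s' - h1
      rw [PiLp.norm_eq_ciSup]
      have hx : ∀ j, ‖(WithLp.toLp ∞ x).ofLp j‖ = |x j| := fun j => rfl
      simp only [hx]
      apply le_antisymm
      · refine h1.2 ?_
        rintro a (rfl | ⟨j, -, rfl⟩)
        · exact Real.iSup_nonneg fun j => abs_nonneg _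
        · exact le_ciSup (f := fun j => |x j|) (Set.finite_range _).bddAbove j
      · exact Real.iSup_le (fun j => h1.1 (.inr ⟨j, j.2, rfl⟩)) (h1.1 (.inl rfl))

end RealRAM

namespace RealRAM

/-! ## The programs -/

def pow2 (e : NExp) : RExp := .pow (.cast (.lit 2)) (.cast e)

@[simp] theorem eval_pow2 (e : NExp) (s : State) : (pow2 e).eval s = 2 ^ e.eval s := by
  simp [pow2]

def nExp : NExp := .get 0 (.lit 0) (.lit 0)

def dExp : NExp := .get 0 (.lit 0) (.lit 1)

def epsExp : RExp := .get 0 (.lit 0) (.lit 0)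

def phiExp : RExp := .get 0 (.lit 0) (.lit 1)

/-- The `ℓ_p`-norm of the all-ones vector. -/
def dimFactor : RExp := .pow (.cast dExp) (.div (.cast (.lit 1)) (.get 0 (.lit 0) (.lit 2)))

/-- The numbers of binary digits: `5` for coordinates, `6` for labels, `7` for levels. -/
def parameters : Cmd :=
  .seq (searchLoop 5 (.rlt (.mul (pow2 (nv 5)) epsExp) (.cast (.lit 64)))) <|
  .seq (searchLoop 6 (.rlt (pow2 (nv 6)) (.cast nExp)))
    (searchLoop 7 (.rlt (.pow (.cast (.lit 2)) (pow2 (nv 7))) (.mul (.cast (.lit 2)) phiExp)))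

def encodeNat (e K : NExp) : Cmd :=
  .seq (setN 2 K) (.seq (setR 3 (.div (.cast e) (pow2 K))) encode)

def decodeNat (K : NExp) : Cmd :=
  .seq (setN 2 K) (.seq decode
    (searchLoop 20 (.rlt (.cast (nv 20)) (.mul (rv 5) (pow2 K)))))

/-- Tabulate the distances in the real table `9`. -/
def distances : Cmd :=
  forLoop 9 0 nExp <| forLoop 10 0 nExp <|
    .seq (normOf (.sub (.get 1 (nv 9) (nv 19)) (.get 1 (nv 10) (nv 19))))
      (.setReal 9 (nv 9) (nv 10) (rv 12))

/-- Find a closest pair `(11, 12)` of a point marked in the table `16` and an unmarked one. -/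
def closestPair : Cmd :=
  .seq (setR 10 (.add phiExp (.cast (.lit 1)))) <|
  forLoop 9 0 nExp <| forLoop 10 0 nExp <|
    .ite (.and (.nlt (.lit 0) (.get 16 (nv 9) (.lit 0)))
        (.and (.nlt (.get 16 (nv 10) (.lit 0)) (.lit 1)) (.rlt (.get 9 (nv 9) (nv 10)) (rv 10))))
      (.seq (setR 10 (.get 9 (nv 9) (nv 10))) (.seq (setN 11 (nv 9)) (setN 12 (nv 10)))) .skip

/-- The level of the distance found by `closestPair`. -/
def pairLevel : Cmd := searchLoop 13 (.rlt (pow2 (nv 13)) (rv 10))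

/-- The last point, in the order of attachment, whose level exceeds the variable `13`. -/
def blockStart : Cmd :=
  .seq (setN 14 (.lit 0)) <|
  forLoop 9 0 (nv 8) <|
    .ite (.nlt (nv 13) (.get 18 (nv 9) (.lit 0))) (setN 14 (nv 9)) .skip

/-- The position of the point `12` is that of the point `11` plus a multiple of the vector whose
coordinates pass through the real variable `5`. -/
def placeCoordinate : Cmd :=
  .setReal 8 (nv 12) (nv 15)
    (.add (.get 8 (nv 11) (nv 15)) (.div (.mul (rv 5) (pow2 (nv 13))) dimFactor))

def encodeVector : Cmd :=
  .seq (setN 2 (nv 5)) <|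
  forLoop 15 0 dExp <|
    .seq (setR 3 (.div (.mul (.sub
        (.sub (.get 1 (nv 12) (nv 15)) (.get 1 (.get 17 (nv 14) (.lit 0)) (nv 15)))
        (.sub (.get 8 (nv 11) (nv 15)) (.get 8 (.get 17 (nv 14) (.lit 0)) (nv 15))))
        dimFactor) (pow2 (nv 13)))) <|
    .seq encode placeCoordinate

def decodeVector : Cmd :=
  .seq (setN 2 (nv 5)) <| forLoop 15 0 dExp <| .seq decode placeCoordinate

/-- Attach one more point to the marked ones. -/
def attach : Cmd :=
  .seq closestPair <| .seq pairLevel <| .seq blockStart <|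
  .seq (encodeNat (nv 12) (nv 6)) <| .seq (encodeNat (nv 11) (nv 6)) <|
  .seq (encodeNat (nv 13) (nv 7)) <| .seq encodeVector <|
  .seq (.setNat 16 (nv 12) (.lit 0) (.lit 1)) <|
  .seq (.setNat 17 (nv 8) (.lit 0) (nv 12)) (.setNat 18 (nv 8) (.lit 0) (nv 13))

/-- Fill the output up to its prescribed length. -/
def padding : Cmd :=
  .loop (.rlt (.cast (nv 4)) (.mul (.cast nExp)
    (.add (.cast (.add (.add (.add (nv 6) (nv 6)) (nv 7)) (.lit 9)))
      (.mul (.cast dExp) (.cast (.add (nv 5) (.lit 4))))))) (emitBit false)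

def summarize : Cmd :=
  .seq parameters <| .seq distances <| .seq (.setNat 16 (.lit 0) (.lit 0) (.lit 1)) <|
  .seq (forLoop 8 1 nExp attach) padding

def readRecord : Cmd :=
  .seq (decodeNat (nv 6)) <| .seq (setN 12 (nv 20)) <|
  .seq (decodeNat (nv 6)) <| .seq (setN 11 (nv 20)) <|
  .seq (decodeNat (nv 7)) <| .seq (setN 13 (nv 20)) decodeVector

def estimate : Cmd :=
  .seq parameters <| .seq (forLoop 8 1 nExp readRecord) <|
  .seq (normOf (.sub (.get 8 (.get 0 (.lit 0) (.lit 2)) (nv 19))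
    (.get 8 (.get 0 (.lit 0) (.lit 3)) (nv 19))))
  (setR 2 (.mul (rv 12) (.add (.cast (.lit 1)) (.div epsExp (.cast (.lit 4))))))

/-! ## Parameters -/

/-- The relations between the parameters of the problem and the numbers of binary digits, with
a common bound `B` for everything that is counted. -/
structure Setup (p : ℝ≥0∞) (n d : ℕ) (ε Φ : ℝ) (k w l B : ℕ) : Prop where
  one_le_p : 1 ≤ p
  two_le_n : 2 ≤ n
  one_le_d : 1 ≤ d
  eps_pos : 0 < ε
  eps_le : ε ≤ 1 / 2
  two_le_phi : 2 ≤ Φ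
  coord : IsLeast {m : ℕ | 64 ≤ 2 ^ m * ε} k
  label : IsLeast {m : ℕ | (n : ℝ) ≤ 2 ^ m} w
  level : IsLeast {m : ℕ | 2 * Φ ≤ 2 ^ 2 ^ m} l
  n_le : n ≤ B
  d_le : 2 * d + k + 3 ≤ B
  coord_le : d * (k + 4) ≤ B
  w_le : w + 3 ≤ B
  l_le : l + 3 ≤ B
  phi_le : Φ ≤ 2 ^ B

/-- The parameters are in their places. -/
structure Ready (p : ℝ≥0∞) (n d : ℕ) (ε Φ : ℝ) (k w l : ℕ) (s : State) : Prop where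
  n : s.nat 0 0 0 = n
  d : s.nat 0 0 1 = d
  eps : s.real 0 0 0 = ε
  phi : s.real 0 0 1 = Φ
  p : s.real 0 0 2 = p.toReal
  k : s.nat 5 0 0 = k
  w : s.nat 6 0 0 = w
  l : s.nat 7 0 0 = l

section

variable {p : ℝ≥0∞} {n d : ℕ} {ε Φ : ℝ} {k w l B : ℕ}

theorem Ready.congr {s s' : State} (h : Ready p n d ε Φ k w l s) (h0 : s'.nat 0 = s.nat 0)
    (h5 : s'.nat 5 = s.nat 5) (h6 : s'.nat 6 = s.nat 6) (h7 : s'.nat 7 = s.nat 7)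
    (hr : s'.real 0 = s.real 0) : Ready p n d ε Φ k w l s' :=
  ⟨by rw [h0]; exact h.n, by rw [h0]; exact h.d, by rw [hr]; exact h.eps,
    by rw [hr]; exact h.phi, by rw [hr]; exact h.p, by rw [h5]; exact h.k, by rw [h6]; exact h.w,
    by rw [h7]; exact h.l⟩

theorem Ready.frame {c : Cmd} {s s' : State} (h : Ready p n d ε Φ k w l s) (f : Frame c s s')
    (h0 : c.writesNat 0 = false) (h5 : c.writesNat 5 = false) (h6 : c.writesNat 6 = false)
    (h7 : c.writesNat 7 = false) (hr : c.writesReal 0 = false) : Ready p n d ε Φ k w l s' :=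
  h.congr (f.nat 0 h0) (f.nat 5 h5) (f.nat 6 h6) (f.nat 7 h7) (f.real 0 hr)

theorem Ready.eval_nExp {s : State} (h : Ready p n d ε Φ k w l s) : nExp.eval s = n := h.n

theorem Ready.eval_dExp {s : State} (h : Ready p n d ε Φ k w l s) : dExp.eval s = d := h.d

theorem Ready.eval_dimFactor {s : State} (h : Ready p n d ε Φ k w l s) :
    dimFactor.eval s = (d : ℝ) ^ (1 / p.toReal) := by
  simp [dimFactor, h.eval_dExp, h.p]

theorem Wp.searchLoop_isLeast {a : ℕ} {b : BExp} {s : State} {N B : ℕ} {P : ℕ → Prop}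
    (hP : IsLeast {m | P m} N) (hb : ∀ m, b.holds (s.wn a 0 0 m) ↔ ¬ P m) (hN : N ≤ B) :
    Wp (RealRAM.searchLoop a b) (B * 2 + 2) s (fun s' => s' = s.wn a 0 0 N) := by
  refine Wp.searchLoop (fun m hm => ?_) hN
  rw [hb]
  constructor
  · intro h
    exact lt_of_le_of_ne hm fun e => h (e ▸ hP.1)
  · intro h h'
    exact absurd (hP.2 h') (by omega)

theorem Setup.wp_parameters (H : Setup p n d ε Φ k w l B) {s : State} (hn : s.nat 0 0 0 = n)
    (hd : s.nat 0 0 1 = d) (hε : s.real 0 0 0 = ε) (hΦ : s.real 0 0 1 = Φ)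
    (hp : s.real 0 0 2 = p.toReal) :
    Wp parameters (6 * B + 6) s (Ready p n d ε Φ k w l) := by
  have hk := H.d_le
  have hw := H.w_le
  have hl := H.l_le
  refine Wp.seqLe (T₁ := B * 2 + 2) (T₂ := 4 * B + 4) (by omega)
    (Wp.searchLoop_isLeast H.coord (fun m => ?_) (by omega)) ?_
  · simp [epsExp, hε]
  rintro _ - rfl
  refine Wp.seqLe (T₁ := B * 2 + 2) (T₂ := 2 * B + 2) (by omega)
    (Wp.searchLoop_isLeast H.label (fun m => ?_) (by omega)) ?_
  · simp [nExp, hn]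
  rintro _ - rfl
  refine ((Wp.searchLoop_isLeast (B := B) H.level (fun m => ?_) (by omega)).le (by omega)).post ?_
  · have : (2 : ℝ) ^ ((2 : ℝ) ^ m) = 2 ^ (2 ^ m) := by
      rw [← Real.rpow_natCast 2 (2 ^ m)]; norm_num
    simp [phiExp, hΦ, this]
  · rintro _ - rfl
    constructor <;> simp [*]

/-! ## Coding of natural numbers -/

/-- `r * 2 ^ K` determines `v`. -/
def Codes (K : ℕ) (r : ℝ) (v : ℕ) : Prop := (v : ℝ) - 1 < r * 2 ^ K ∧ r * 2 ^ K ≤ v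

/-- A natural number below 2^K is written as the fraction v / 2^K of [0, 1), so it takes `K` digits
and O(1) further bits instead of a unary code. -/
theorem wp_encodeNat {e : NExp} {c : ℕ} {s : State} {v K : ℕ}
    (he : ∀ x, e.eval (s.wn 2 0 0 x) = v) (hc : c ≠ 2) (hK : s.nat c 0 0 = K)
    (hcnt : s.nat 4 0 0 = s.out.length) (hKB : K ≤ B) (hB : 1 ≤ B) (hv : v < 2 ^ K) :
    Wp (encodeNat e (nv c)) (13 * B + 22) s (fun s' => s'.nat 4 0 0 = s'.out.length ∧
      ∃ L r, IsCode K L r ∧ Codes K r v ∧ s'.out = s.out ++ L ∧ L.length ≤ K + 3) := by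
  have hc2 : (c = 2) = False := by simp [hc]
  apply Wp.setNat_seq
  apply Wp.setReal_seq
  have hpos : (0 : ℝ) < 2 ^ K := by positivity
  have hv' : (v : ℝ) < 2 ^ K := by exact_mod_cast hv
  have h0 : (0 : ℝ) ≤ v / 2 ^ K := by positivity
  have h1 : (v : ℝ) / 2 ^ K ≤ 1 := by rw [div_le_one hpos]; exact hv'.le
  refine (wp_encode (B := B) (y := v / 2 ^ K) (K := K) ?_ ?_ ?_ hKB ?_).post ?_
  · have := he K
    simp only [NExp.eval, hK] at this ⊢
    simp [hc2, hK, this]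
  · simp [hK]
  · simp [hcnt]
  · rw [abs_of_nonneg h0]
    exact h1.trans (by exact_mod_cast hB)
  · rintro s' - ⟨h, L, r, hL, ho, -, hr1, hr2, hlen⟩
    refine ⟨h, L, r, hL, ⟨?_, ?_⟩, by simpa using ho, ?_⟩
    · rw [abs_lt] at hr2
      have : (v / 2 ^ K - (1 / 2) ^ K : ℝ) * 2 ^ K < r * 2 ^ K := by
        apply mul_lt_mul_of_pos_right _ hpos
        linarith
      rw [sub_mul, div_mul_cancel₀ _ hpos.ne', ← mul_pow] at this
      simpa using this
    · rw [← le_div_iff₀ hpos]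
      rw [abs_of_nonneg h0] at hr1
      exact (le_abs_self r).trans hr1
    · rw [abs_of_nonneg h0] at hlen
      have : (L.length : ℝ) ≤ ((K + 3 : ℕ) : ℝ) := by push_cast; linarith
      exact_mod_cast this

/-- Since v − 1 < r·2^K ≤ v, the search for the least natural number not below r·2^K stops at `v`.
-/
theorem wp_decodeNat {c : ℕ} {s : State} {v K : ℕ} {S L rest : List Bool} {r : ℝ}
    (hS : Tape S s) (hc2 : c ≠ 2) (hc : decode.writesNat c = false) (hc20 : c ≠ 20)
    (hK : s.nat c 0 0 = K) (hL : IsCode K L r) (hv : Codes K r v)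
    (hdrop : S.drop (s.nat 4 0 0) = L ++ rest) (hB : L.length ≤ B) (hvB : v ≤ B) :
    Wp (decodeNat (nv c)) (11 * B + 23) s (fun s' => S.drop (s'.nat 4 0 0) = rest ∧
      s'.nat 20 0 0 = v) := by
  have hc2' : (c = 2) = False := by simp [hc2]
  have hc20' : (c = 20) = False := by simp [hc20]
  apply Wp.setNat_seq
  refine Wp.seqLe (T₁ := 9 * B + 20) (T₂ := B * 2 + 2) (by omega)
    (wp_decode (hS.congr ?_) (by simp [hK]) hL (by simpa using hdrop) hB) ?_
  · funext i j
    simp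
  rintro s' f ⟨h1, h2⟩
  have hK' : s'.nat c 0 0 = K := by rw [f.nat c hc]; simp [hK, hc2']
  refine (Wp.searchLoop (N := v) (fun m hm => ?_) hvB).post ?_
  · simp only [BExp.holds, RExp.eval, NExp.eval, eval_pow2]
    simp only [State.wn_nat, State.wn_real, hc20', false_and, if_false, and_self, if_true, hK', h2]
    constructor
    · intro h
      exact_mod_cast h.trans_le hv.2
    · intro h
      have : (m : ℝ) + 1 ≤ v := by exact_mod_cast h
      linarith [hv.1]
  · rintro _ - rfl
    simpa using h1

end

end RealRAM

/-! ## Points attached one by one -/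

/-- The first `d` terms of a sequence as a vector of `ℓ_p^d`. -/
noncomputable def vec (p : ℝ≥0∞) (d : ℕ) (x : ℕ → ℝ) : PiLp p (fun _ : Fin d => ℝ) :=
  WithLp.toLp p (fun j : Fin d => x j)

theorem vec_sub (p : ℝ≥0∞) (d : ℕ) (x y : ℕ → ℝ) : vec p d (x - y) = vec p d x - vec p d y := rfl

/-- The points `ord 0, …, ord (i - 1)` with true coordinates `F` have been attached in this order,
each at distance about `2 ^ lev m` from its predecessors, and have received coordinates `X`. -/
structure PrimInv (p : ℝ≥0∞) [Fact (1 ≤ p)] (d n : ℕ) (F : ℕ → ℕ → ℝ) (δ : ℝ) (i : ℕ)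
    (ord lev : ℕ → ℕ) (X : ℕ → ℕ → ℝ) : Prop where
  ord_lt : ∀ m < i, ord m < n
  ord_inj : ∀ m < i, ∀ m' < i, ord m = ord m' → m = m'
  cut : ∀ m, 1 ≤ m → m < i → ∀ a < m, ∀ b < n, (∀ m' < m, ord m' ≠ b) →
    (2 : ℝ) ^ lev m < 2 * ‖vec p d (F (ord a) - F b)‖
  close : LevelwiseClose i (fun m => vec p d (X (ord m) - F (ord m))) lev δ

section

variable {p : ℝ≥0∞} [Fact (1 ≤ p)] {d n i : ℕ} {F X : ℕ → ℕ → ℝ} {δ : ℝ} {ord lev : ℕ → ℕ}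

/-- The displacement is the true step from `ord a` to `v`, of norm at most 2^l, corrected by the
error of `ord a` relative to that of `ord r`. The base lies in the block of the reference, so this
correction is at most 2δ·2^l ≤ 2^l. -/
theorem PrimInv.norm_displacement_le (h : PrimInv p d n F δ i ord lev X) (hδ0 : 0 ≤ δ)
    (hδ : δ ≤ 1 / 2) {a v l r : ℕ} (ha : a < i) (hv : v < n) (hvis : ∀ m < i, ord m ≠ v)
    (hl : ‖vec p d (F (ord a) - F v)‖ ≤ 2 ^ l) (hr : r < i) (hr0 : r = 0 ∨ l < lev r)
    (hmax : ∀ m, r < m → m < i → lev m ≤ l) :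
    ‖vec p d ((F v - F (ord r)) - (X (ord a) - X (ord r)))‖ ≤ 2 * 2 ^ l := by
  -- Were the base older than the reference, the pair (`ord a`, `v`) would have crossed the cut when
  -- `ord r` was attached, forcing lev r ≤ l.
  have hra : r ≤ a := by
    by_contra! har
    rcases hr0 with rfl | hr0
    · omega
    · have h1 := h.cut r (by omega) hr a har v hv fun m hm => hvis m (by omega)
      have h2 : (2 : ℝ) ^ (l + 1) ≤ 2 ^ lev r := pow_le_pow_right₀ (by norm_num) hr0
      rw [pow_succ] at h2
      linarith
  have h1 := h.close.norm_sub_start_le hδ0 hr0 hra ha fun m h1 h2 => hmax m h1 (by omega)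
  have h2 : vec p d ((F v - F (ord r)) - (X (ord a) - X (ord r))) =
      -(vec p d (F (ord a) - F v)) -
        (vec p d (X (ord a) - F (ord a)) - vec p d (X (ord r) - F (ord r))) := by
    simp only [vec_sub]; abel
  rw [h2]
  refine (norm_sub_le _ _).trans ?_
  rw [norm_neg]
  have : (0 : ℝ) < 2 ^ l := by positivity
  nlinarith

/-- Only the row of `v` changes, and `v` was not attached before, so all earlier errors keep their
values. -/
theorem PrimInv.attach (h : PrimInv p d n F δ i ord lev X) {ord' lev' : ℕ → ℕ}
    {X' : ℕ → ℕ → ℝ} {v l r : ℕ} (ho : ∀ m < i, ord' m = ord m) (hov : ord' i = v)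
    (hl : ∀ m < i, lev' m = lev m) (hlv : lev' i = l) (hX : ∀ a ≠ v, X' a = X a)
    (hv : v < n) (hvis : ∀ m < i, ord m ≠ v)
    (hcut : ∀ a < i, ∀ b < n, (∀ m < i, ord m ≠ b) →
      (2 : ℝ) ^ l < 2 * ‖vec p d (F (ord a) - F b)‖)
    (hr : r < i) (hr0 : r = 0 ∨ l < lev r) (hmax : ∀ m, r < m → m < i → lev m ≤ l)
    (hclose : ‖vec p d ((X' v - F v) - (X (ord r) - F (ord r)))‖ ≤ δ * 2 ^ l) :
    PrimInv p d n F δ (i + 1) ord' lev' X' := by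
  constructor
  · intro m hm
    rcases Nat.lt_succ_iff_lt_or_eq.1 hm with hm | rfl
    · rw [ho m hm]; exact h.ord_lt m hm
    · rwa [hov]
  · intro m hm m' hm' e
    rcases Nat.lt_succ_iff_lt_or_eq.1 hm with hm | rfl <;>
      rcases Nat.lt_succ_iff_lt_or_eq.1 hm' with hm' | rfl
    · rw [ho m hm, ho m' hm'] at e
      exact h.ord_inj m hm m' hm' e
    · rw [ho m hm, hov] at e
      exact absurd e (hvis m hm)
    · rw [ho m' hm', hov] at e
      exact absurd e.symm (hvis m' hm')
    · rfl
  · intro m h1 hm a ha b hb hb'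
    rw [ho a (by omega)]
    rcases Nat.lt_succ_iff_lt_or_eq.1 hm with hm | rfl
    · rw [hl m hm]
      exact h.cut m h1 hm a ha b hb fun m' hm' => by rw [← ho m' (by omega)]; exact hb' m' hm'
    · rw [hlv]
      exact hcut a ha b hb fun m' hm' => by rw [← ho m' (by omega)]; exact hb' m' hm'
  · have key : ∀ m < i, vec p d (X' (ord' m) - F (ord' m)) = vec p d (X (ord m) - F (ord m)) := by
      intro m hm
      rw [ho m hm, hX _ (hvis m hm)]
    intro j h1 hj
    rcases Nat.lt_succ_iff_lt_or_eq.1 hj with hj | rfl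
    · obtain ⟨s, h2, h3, h4, h5⟩ := h.close j h1 hj
      refine ⟨s, h2, ?_, fun m hm1 hm2 => ?_, ?_⟩
      · simp only [key j hj, key s (h2.trans hj), hl j hj]
        exact h3
      · rw [hl m (by omega), hl j hj]; exact h4 m hm1 hm2
      · rw [hl s (by omega), hl j hj]; exact h5
    · refine ⟨r, hr, ?_, fun m hm1 hm2 => ?_, ?_⟩
      · simp only [key r hr, hov, hlv]
        rw [← vec_sub]
        exact hclose
      · rw [hl m hm2, hlv]; exact hmax m hm1 hm2
      · rw [hl r hr, hlv]; exact hr0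

theorem exists_lt_forall_ne (ord : ℕ → ℕ) (h : i < n) : ∃ b < n, ∀ m < i, ord m ≠ b := by
  by_contra! hcon
  have : Finset.range n ⊆ (Finset.range i).image ord := by
    intro b hb
    obtain ⟨m, hm, hmb⟩ := hcon b (Finset.mem_range.1 hb)
    exact Finset.mem_image.2 ⟨m, Finset.mem_range.2 hm, hmb⟩
  have := (Finset.card_le_card this).trans Finset.card_image_le
  simp at this
  omega

theorem PrimInv.exists_ord_eq (h : PrimInv p d n F δ n ord lev X) {x : ℕ} (hx : x < n) :
    ∃ m < n, ord m = x := by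
  have hi : Function.Injective (fun m : Fin n => (⟨ord m, h.ord_lt m m.2⟩ : Fin n)) :=
    fun a b hab => Fin.ext (h.ord_inj a a.2 b b.2 (by simpa using hab))
  obtain ⟨m, hm⟩ := (Finite.injective_iff_surjective.1 hi) ⟨x, hx⟩
  exact ⟨m, m.2, by simpa using hm⟩

/-- Approximate and true difference vectors differ by the difference of the two errors. Injectivity
of `ord` shows that the later point is still unattached at every step up to its own, so the cut
property applies throughout. -/
theorem PrimInv.abs_norm_sub_norm_le (h : PrimInv p d n F δ n ord lev X) (hδ : 0 ≤ δ) {x y : ℕ}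
    (hx : x < n) (hy : y < n) :
    |‖vec p d (X x - X y)‖ - ‖vec p d (F x - F y)‖| ≤ 8 * δ * ‖vec p d (F x - F y)‖ := by
  have key : ∀ a b, a < b → b < n →
      |‖vec p d (X (ord a) - X (ord b))‖ - ‖vec p d (F (ord a) - F (ord b))‖| ≤
        8 * δ * ‖vec p d (F (ord a) - F (ord b))‖ := by
    intro a b hab hb
    refine (_root_.abs_norm_sub_norm_le _ _).trans ?_
    have h1 := h.close.norm_sub_le_mul hδ
      (dist := fun a b => ‖vec p d (F (ord a) - F (ord b))‖) (fun m a b ham hmb hbn =>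
        (h.cut m (by omega) (by omega) a ham _ (h.ord_lt b hbn) fun m' hm' e => by
          have := h.ord_inj m' (by omega) b hbn e
          omega).le) hab hb
    refine le_of_eq_of_le (congrArg norm ?_) h1
    simp only [vec_sub]
    abel
  obtain ⟨a, ha, rfl⟩ := h.exists_ord_eq hx
  obtain ⟨b, hb, rfl⟩ := h.exists_ord_eq hy
  rcases lt_trichotomy a b with hab | rfl | hab
  · exact key a b hab hb
  · simp only [sub_self, abs_zero]
    positivity
  · have := key b a hab ha
    simp only [vec_sub] at this ⊢
    rwa [norm_sub_rev (vec p d (X (ord b))), norm_sub_rev (vec p d (F (ord b)))] at this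

end

/-! ## Sketches as sequences of attachments -/

/-- The point `point` is placed relative to the point `base`, at a scale of `2 ^ level`. -/
structure Attachment where
  point : ℕ
  base : ℕ
  level : ℕ
  coords : List ℝ

/-- The coordinates after an attachment has been carried out for the first `j` coordinates. -/
noncomputable def place (c : ℝ) (j : ℕ) (X : ℕ → ℕ → ℝ) (R : Attachment) : ℕ → ℕ → ℝ :=
  fun a j' => if a = R.point ∧ j' < j then
    X R.base j' + R.coords.getD j' 0 * 2 ^ R.level / c else X a j'

/-- `L` is the code of the attachment `R`. -/
def IsRecord (n d k w l B : ℕ) (R : Attachment) (L : List Bool) : Prop :=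
  ∃ L₁ L₂ L₃ L₄ r₁ r₂ r₃, L = L₁ ++ (L₂ ++ (L₃ ++ L₄)) ∧
    (IsCode w L₁ r₁ ∧ RealRAM.Codes w r₁ R.point ∧ R.point < n) ∧
    (IsCode w L₂ r₂ ∧ RealRAM.Codes w r₂ R.base ∧ R.base < n) ∧
    (IsCode l L₃ r₃ ∧ RealRAM.Codes l r₃ R.level ∧ R.level ≤ B) ∧
    R.coords.length = d ∧ IsStream (R.coords.map fun z => (k, z)) L₄ ∧
    L₁.length ≤ w + 3 ∧ L₂.length ≤ w + 3 ∧ L₃.length ≤ l + 3 ∧ L₄.length ≤ d * (k + 4)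

/-- `L` is the concatenation of the codes of a sequence of attachments. -/
def IsSketch (n d k w l B : ℕ) : List Attachment → List Bool → Prop
  | [], L => L = []
  | R :: Rs, L => ∃ L₁ L₂, L = L₁ ++ L₂ ∧ IsRecord n d k w l B R L₁ ∧ IsSketch n d k w l B Rs L₂

theorem IsSketch.snoc {n d k w l B : ℕ} {Rs : List Attachment} {R : Attachment}
    {L L' : List Bool} (h : IsSketch n d k w l B Rs L) (h' : IsRecord n d k w l B R L') :
    IsSketch n d k w l B (Rs ++ [R]) (L ++ L') := by
  induction Rs generalizing L with
  | nil =>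
    obtain rfl : L = [] := h
    exact ⟨L', [], by simp, h', rfl⟩
  | cons x xs ih =>
    obtain ⟨L₁, L₂, rfl, h1, h2⟩ := h
    exact ⟨L₁, L₂ ++ L', by simp, h1, ih h2⟩

/-- Coordinates are overwritten in place. Column `j` is untouched when its turn comes, so the base
is read with its old value. -/
theorem place_write {s : RealRAM.State} {c : ℝ} {j v u l : ℕ} {X : ℕ → ℕ → ℝ} {z : List ℝ}
    (h : s.real 8 = place c j X ⟨v, u, l, z⟩) :
    (s.wr 8 v j (s.real 8 u j + z.getD j 0 * 2 ^ l / c)).real 8 =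
      place c (j + 1) X ⟨v, u, l, z⟩ := by
  funext a j'
  simp only [RealRAM.State.wr_real, h, place, lt_self_iff_false, and_false, if_false, true_and]
  by_cases ha : a = v
  · rcases lt_trichotomy j' j with hj | rfl | hj
    · have : j' ≠ j := hj.ne
      simp [ha, this, hj, hj.trans (Nat.lt_succ_self j)]
    · simp [ha]
    · have h1 : ¬ j' < j + 1 := by omega
      simp [hj.ne', h1, hj.not_gt]
  · simp [ha]

theorem place_snoc {c : ℝ} {j v u l : ℕ} {X : ℕ → ℕ → ℝ} {z : List ℝ} {r : ℝ}
    (hz : z.length = j) :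
    place c j X ⟨v, u, l, z ++ [r]⟩ = place c j X ⟨v, u, l, z⟩ := by
  funext a j'
  unfold place
  by_cases h : a = v ∧ j' < j
  · simp [h, List.getElem?_append, hz]
  · simp [h]

theorem place_apply_self {c : ℝ} {j a : ℕ} {X : ℕ → ℕ → ℝ} {R : Attachment} :
    place c j X R a j = X a j := by
  simp [place]

namespace RealRAM

section

variable {p : ℝ≥0∞} {n d : ℕ} {ε Φ : ℝ} {k w l B : ℕ}

/-! ## Reading a sketch -/

theorem Setup.wp_decodeVector (H : Setup p n d ε Φ k w l B) {s : State}
    (hs : Ready p n d ε Φ k w l s) {S L rest : List Bool} (hS : Tape S s) {v u lv : ℕ}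
    (hv : s.nat 12 0 0 = v) (hu : s.nat 11 0 0 = u) (hlv : s.nat 13 0 0 = lv) {z : List ℝ}
    (hz : z.length = d) (hL : IsStream (z.map fun z => (k, z)) L)
    (hdrop : S.drop (s.nat 4 0 0) = L ++ rest) (hLB : L.length ≤ d * (k + 4)) :
    Wp decodeVector (B * (9 * B + 23) + 3) s (fun s' => S.drop (s'.nat 4 0 0) = rest ∧
      s'.real 8 = place ((d : ℝ) ^ (1 / p.toReal)) d (s.real 8) ⟨v, u, lv, z⟩) := by
  have hdB : d ≤ B := by have := H.d_le; omega
  set c := (d : ℝ) ^ (1 / p.toReal) with hc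
  apply Wp.setNat_seq
  refine ((Wp.forLoop (N := d) (B := B) (T := 9 * B + 21) (fun j s' =>
    (∃ L', IsStream ((z.drop j).map fun z => (k, z)) L' ∧ S.drop (s'.nat 4 0 0) = L' ++ rest ∧
      L'.length ≤ d * (k + 4)) ∧ s'.real 8 = place c j (s.real 8) ⟨v, u, lv, z⟩)
    rfl (Nat.zero_le _) hdB ?_ ?_ ?_).le (by ring_nf; omega)).post ?_
  · intro s' f
    exact (hs.congr (s' := s') (f.nat 0 rfl) (f.nat 5 rfl) (f.nat 6 rfl) (f.nat 7 rfl)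
      (f.real 0 rfl)).eval_dExp
  · refine ⟨⟨L, by simpa using hL, by simpa using hdrop, hLB⟩, ?_⟩
    funext a j
    simp [place]
  · rintro j - hj s' f hcj ⟨⟨L', h1, h2, h3⟩, h4⟩
    have hs' : Ready p n d ε Φ k w l s' := hs.congr (s' := s') (f.nat 0 rfl) (f.nat 5 rfl)
      (f.nat 6 rfl) (f.nat 7 rfl) (f.real 0 rfl)
    have e12 : s'.nat 12 0 0 = v := by rw [f.nat 12 rfl]; simpa using hv
    have e11 : s'.nat 11 0 0 = u := by rw [f.nat 11 rfl]; simpa using hu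
    have e13 : s'.nat 13 0 0 = lv := by rw [f.nat 13 rfl]; simpa using hlv
    have e2 : s'.nat 2 0 0 = k := by rw [f.nat 2 rfl]; simpa using hs.k
    have hS' : Tape S s' := hS.congr (by rw [f.nat 1 rfl]; funext i j; simp)
    have hj' : j < z.length := by omega
    rw [List.drop_eq_getElem_cons hj', List.map_cons] at h1
    obtain ⟨L₁, L₂, rfl, h5, h6⟩ := h1
    rw [List.length_append] at h3
    refine Wp.seq (T₂ := 1) (wp_decode (B := B) (rest := L₂ ++ rest) hS' e2 h5 (by simp [h2])
      (by have := H.coord_le; omega)) ?_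
    rintro s'' f' ⟨h7, h8⟩
    have hs'' := hs'.frame f' rfl rfl rfl rfl rfl
    have e8 : s''.real 8 = s'.real 8 := f'.real 8 rfl
    have g12 : s''.nat 12 0 0 = v := by rw [f'.nat 12 rfl, e12]
    have g11 : s''.nat 11 0 0 = u := by rw [f'.nat 11 rfl, e11]
    have g13 : s''.nat 13 0 0 = lv := by rw [f'.nat 13 rfl, e13]
    have g15 : s''.nat 15 0 0 = j := by rw [f'.nat 15 rfl, hcj]
    apply Wp.setReal
    refine ⟨⟨L₂, h6, by simpa using h7, by omega⟩, ?_⟩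
    have := place_write (s := s'') (e8.trans h4)
    rw [← this]
    simp only [NExp.eval, RExp.eval, eval_pow2, g12, g11, g13, g15, hs''.eval_dimFactor, h8,
      State.wn_real, List.getD_eq_getElem _ _ hj', hc]
  · rintro s' - ⟨⟨L', h1, h2, h3⟩, h4⟩
    rw [List.drop_eq_nil_of_le (by omega)] at h1
    obtain rfl : L' = [] := h1
    exact ⟨by simpa using h2, h4⟩

theorem Setup.wp_readRecord (H : Setup p n d ε Φ k w l B) {s : State}
    (hs : Ready p n d ε Φ k w l s) {S L rest : List Bool} (hS : Tape S s) {R : Attachment}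
    (hL : IsRecord n d k w l B R L) (hdrop : S.drop (s.nat 4 0 0) = L ++ rest) :
    Wp readRecord (B * (9 * B + 23) + 33 * B + 75) s (fun s' => S.drop (s'.nat 4 0 0) = rest ∧
      s'.real 8 = place ((d : ℝ) ^ (1 / p.toReal)) d (s.real 8) R) := by
  obtain ⟨L₁, L₂, L₃, L₄, r₁, r₂, r₃, rfl, ⟨a1, a2, a3⟩, ⟨b1, b2, b3⟩, ⟨c1, c2, c3⟩, hz, h4,
    l1, l2, l3, l4⟩ := hL
  have hnB := H.n_le
  have hwB := H.w_le
  have hlB := H.l_le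
  rw [List.append_assoc] at hdrop
  refine Wp.seqLe (T₁ := 11 * B + 23) (T₂ := B * (9 * B + 23) + 22 * B + 52) (by omega)
    (wp_decodeNat (B := B) hS (by decide) rfl (by decide) hs.w a1 a2 hdrop (by omega)
      (by omega)) ?_
  rintro s₁ f₁ ⟨d₁, v₁⟩
  apply Wp.setNat_seq
  have hs₁ := hs.frame f₁ rfl rfl rfl rfl rfl
  have hS₁ := hS.congr (f₁.nat 1 rfl)
  have x₁ : s₁.real 8 = s.real 8 := f₁.real 8 rfl
  generalize hg : s₁.wn 12 (NExp.eval s₁ (.lit 0)) (NExp.eval s₁ (.lit 0))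
    (NExp.eval s₁ (nv 20)) = t₁
  have hst₁ : Ready p n d ε Φ k w l t₁ := by
    subst hg
    exact hs₁.congr (by funext i j; simp) (by funext i j; simp) (by funext i j; simp)
      (by funext i j; simp) rfl
  have hSt₁ : Tape S t₁ := by subst hg; exact hS₁.congr (by funext i j; simp)
  have d₁' : S.drop (t₁.nat 4 0 0) = L₂ ++ (L₃ ++ L₄) ++ rest := by subst hg; simpa using d₁
  have v₁' : t₁.nat 12 0 0 = R.point := by subst hg; simpa using v₁
  have x₁' : t₁.real 8 = s.real 8 := by subst hg; simpa using x₁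
  rw [List.append_assoc] at d₁'
  refine Wp.seqLe (T₁ := 11 * B + 23) (T₂ := B * (9 * B + 23) + 11 * B + 28) (by omega)
    (wp_decodeNat (B := B) hSt₁ (by decide) rfl (by decide) hst₁.w b1 b2 d₁' (by omega)
      (by omega)) ?_
  clear hg
  rintro s₂ f₂ ⟨d₂, v₂⟩
  apply Wp.setNat_seq
  have hs₂ := hst₁.frame f₂ rfl rfl rfl rfl rfl
  have hS₂ := hSt₁.congr (f₂.nat 1 rfl)
  have x₂ : s₂.real 8 = s.real 8 := (f₂.real 8 rfl).trans x₁'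
  have y₂ : s₂.nat 12 0 0 = R.point := by rw [f₂.nat 12 rfl, v₁']
  generalize hg : s₂.wn 11 (NExp.eval s₂ (.lit 0)) (NExp.eval s₂ (.lit 0))
    (NExp.eval s₂ (nv 20)) = t₂
  have hst₂ : Ready p n d ε Φ k w l t₂ := by
    subst hg
    exact hs₂.congr (by funext i j; simp) (by funext i j; simp) (by funext i j; simp)
      (by funext i j; simp) rfl
  have hSt₂ : Tape S t₂ := by subst hg; exact hS₂.congr (by funext i j; simp)
  have d₂' : S.drop (t₂.nat 4 0 0) = L₃ ++ L₄ ++ rest := by subst hg; simpa using d₂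
  have v₂' : t₂.nat 11 0 0 = R.base := by subst hg; simpa using v₂
  have y₂' : t₂.nat 12 0 0 = R.point := by subst hg; simpa using y₂
  have x₂' : t₂.real 8 = s.real 8 := by subst hg; simpa using x₂
  rw [List.append_assoc] at d₂'
  refine Wp.seqLe (T₁ := 11 * B + 23) (T₂ := B * (9 * B + 23) + 4) (by omega)
    (wp_decodeNat (B := B) hSt₂ (by decide) rfl (by decide) hst₂.l c1 c2 d₂' (by omega)
      (by omega)) ?_
  clear hg
  rintro s₃ f₃ ⟨d₃, v₃⟩
  apply Wp.setNat_seq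
  have hs₃ := hst₂.frame f₃ rfl rfl rfl rfl rfl
  have hS₃ := hSt₂.congr (f₃.nat 1 rfl)
  have x₃ : s₃.real 8 = s.real 8 := (f₃.real 8 rfl).trans x₂'
  have y₃ : s₃.nat 12 0 0 = R.point := by rw [f₃.nat 12 rfl, y₂']
  have z₃ : s₃.nat 11 0 0 = R.base := by rw [f₃.nat 11 rfl, v₂']
  refine (H.wp_decodeVector (s := s₃.wn 13 0 0 (s₃.nat 20 0 0)) (hs₃.congr (by funext i j; simp) (by funext i j; simp)
    (by funext i j; simp) (by funext i j; simp) rfl) (hS₃.congr (by funext i j; simp))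
    (v := R.point) (u := R.base) (lv := R.level) (z := R.coords) (by simpa using y₃)
    (by simpa using z₃) (by simpa using v₃) hz h4 (by simpa using d₃) l4).post ?_
  rintro s' - ⟨h, h'⟩
  refine ⟨h, ?_⟩
  rw [h', State.wn_real, x₃]

/-- The coordinates after a sequence of attachments. -/
noncomputable def positions (p : ℝ≥0∞) (d : ℕ) (Rs : List Attachment) : ℕ → ℕ → ℝ :=
  Rs.foldl (place ((d : ℝ) ^ (1 / p.toReal)) d) 0

/-- The decoder replays the attachments in exact arithmetic and reaches the very positions the
encoder worked with. The root stays at the origin, the initial content of the table. -/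
theorem Setup.wp_estimate (H : Setup p n d ε Φ k w l B) {S L pad : List Bool} {x y : Fin n}
    {Rs : List Attachment} (hRs : Rs.length + 1 = n) (hL : IsSketch n d k w l B Rs L)
    (hS : S = L ++ pad) :
    Wp estimate (B * (B * (9 * B + 23) + 33 * B + 77) + 11 * B + 19) (estInput p d ε Φ S x y)
      (fun s' => s'.real 2 0 0 =
        ‖vec p d (positions p d Rs x - positions p d Rs y)‖ * (1 + ε / 4)) := by
  set s := estInput p d ε Φ S x y with hs
  have hn2 := H.two_le_n
  have hdB : d ≤ B := by have := H.d_le; omega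
  have hTape : Tape S s := fun i => by simp [hs, estInput]
  refine Wp.seqLe (T₁ := 6 * B + 6) (T₂ := B * (B * (9 * B + 23) + 33 * B + 77) + 5 * B + 13)
    (by omega) (H.wp_parameters (by simp [hs, estInput]) (by simp [hs, estInput])
      (by simp [hs, estInput, paramReals]) (by simp [hs, estInput, paramReals])
      (by simp [hs, estInput, paramReals])) ?_
  intro s₁ f₁ hs₁
  have hT₁ := hTape.congr (f₁.nat 1 rfl)
  have fr : ∀ s', Frame (forLoop 8 1 nExp readRecord) s₁ s' → Ready p n d ε Φ k w l s' :=
    fun s' f => hs₁.frame f rfl rfl rfl rfl rfl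
  refine Wp.seqLe (T₁ := B * ((B * (9 * B + 23) + 33 * B + 75) + 2) + 2) (T₂ := 5 * B + 11)
    (by ring_nf; omega)
    -- The counter includes the root, which has no record: at counter `i`, `i - 1` records have been
    -- read.
    (Wp.forLoop (N := n) (fun i s' =>
      (∃ L', IsSketch n d k w l B (Rs.drop (i - 1)) L' ∧ S.drop (s'.nat 4 0 0) = L' ++ pad) ∧
        s'.real 8 = positions p d (Rs.take (i - 1))) rfl (by omega) H.n_le
        (fun s' f => (fr s' f).eval_nExp) ?_ ?_) ?_
  · refine ⟨⟨L, by simpa using hL, ?_⟩, ?_⟩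
    · have : s₁.nat 4 = s.nat 4 := f₁.nat 4 rfl
      simp [this, hs, estInput, hS]
    · have : s₁.real 8 = s.real 8 := f₁.real 8 rfl
      simp [this, hs, estInput, positions]
      rfl
  · rintro i h1 hi s' f hi' ⟨⟨L', h2, h3⟩, h4⟩
    have hlt : i - 1 < Rs.length := by omega
    rw [List.drop_eq_getElem_cons hlt] at h2
    obtain ⟨L₁, L₂, rfl, h5, h6⟩ := h2
    refine (H.wp_readRecord (rest := L₂ ++ pad) (fr s' f) (hT₁.congr (f.nat 1 rfl)) h5
      (by simp [h3])).post ?_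
    rintro s'' - ⟨h7, h8⟩
    have hi1 : i + 1 - 1 = i - 1 + 1 := by omega
    refine ⟨⟨L₂, by rw [hi1]; exact h6, by simpa using h7⟩, ?_⟩
    rw [hi1, List.take_succ_eq_append_getElem hlt, positions, List.foldl_append]
    simp only [List.foldl_cons, List.foldl_nil, State.wn_real]
    rw [h8, h4]
    rfl
  rintro s₂ f₂ ⟨-, h⟩
  rw [List.take_of_length_le (by omega)] at h
  have hs₂ := fr s₂ f₂
  have e0 : s₂.nat 0 = s.nat 0 := (f₂.nat 0 rfl).trans (f₁.nat 0 rfl)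
  refine Wp.seqLe (T₁ := 5 * B + 10) (T₂ := 1) (by omega)
    (wp_normOf (p := p) (d := d) (B := B) H.one_le_p hs₂.d hs₂.p
      (fun j => positions p d Rs x j - positions p d Rs y j) ?_ hdB) ?_
  · intro s' f j hj
    simp only [RExp.eval, NExp.eval, f.real 8 rfl, f.nat 0 rfl, hj, h, e0]
    simp [hs, estInput]
  · intro s₃ f₃ h₃
    have hs₃ := hs₂.frame f₃ rfl rfl rfl rfl rfl
    apply Wp.setReal
    simp [h₃, epsExp, hs₃.eps]
    left
    rfl

end

end RealRAM

namespace RealRAM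

section

variable {p : ℝ≥0∞} {n d : ℕ} {ε Φ : ℝ} {k w l B : ℕ}

/-! ## Writing a sketch -/

theorem Setup.wp_distances (H : Setup p n d ε Φ k w l B) {s : State}
    (hs : Ready p n d ε Φ k w l s) :
    Wp distances (B * (B * (5 * B + 13) + 4) + 2) s (fun s' => ∀ a < n, ∀ b < n,
      s'.real 9 a b = ‖vec p d (s.real 1 a - s.real 1 b)‖) := by
  have hdB : d ≤ B := by have := H.d_le; omega
  have fr : ∀ s', Frame distances s s' → Ready p n d ε Φ k w l s' :=
    fun s' f => hs.frame f rfl rfl rfl rfl rfl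
  refine Wp.forLoop (N := n) (T := B * (5 * B + 11 + 2) + 2) (fun i s' => ∀ a < i, ∀ b < n,
    s'.real 9 a b = ‖vec p d (s.real 1 a - s.real 1 b)‖) rfl (Nat.zero_le _) H.n_le
    (fun s' f => (fr s' f).eval_nExp) (fun a ha => absurd ha (Nat.not_lt_zero a)) ?_
  rintro i - hi s₁ f₁ hc₁ h₁
  have hs₁ := fr s₁ f₁
  have e₁ : s₁.real 1 = s.real 1 := f₁.real 1 rfl
  refine (Wp.forLoop (N := n) (T := 5 * B + 11) (fun j s' => (∀ a < i, ∀ b < n,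
    s'.real 9 a b = ‖vec p d (s.real 1 a - s.real 1 b)‖) ∧ ∀ b < j,
    s'.real 9 i b = ‖vec p d (s.real 1 i - s.real 1 b)‖) rfl (Nat.zero_le _) H.n_le
    (fun s' f => (hs₁.frame f rfl rfl rfl rfl rfl).eval_nExp) ?_ ?_).post ?_
  · exact ⟨by simpa using h₁, fun b hb => absurd hb (Nat.not_lt_zero b)⟩
  · rintro j - hj s₂ f₂ hc₂ ⟨h₂, h₂'⟩
    have hs₂ := hs₁.frame f₂ rfl rfl rfl rfl rfl
    have e₂ : s₂.real 1 = s.real 1 := (f₂.real 1 rfl).trans e₁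
    have c₂ : s₂.nat 9 0 0 = i := by rw [f₂.nat 9 rfl, hc₁]
    refine Wp.seq (T₂ := 1) (wp_normOf (p := p) (d := d) (B := B) H.one_le_p hs₂.d hs₂.p
      (fun t => s.real 1 i t - s.real 1 j t) (fun s₃ f₃ t ht => ?_) hdB) ?_
    · simp only [RExp.eval, NExp.eval, f₃.real 1 rfl, f₃.nat 9 rfl, f₃.nat 10 rfl, ht, c₂, hc₂, e₂]
    · intro s₃ f₃ h₃
      apply Wp.setReal
      have x9 : s₃.nat 9 0 0 = i := by rw [f₃.nat 9 rfl, c₂]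
      have x10 : s₃.nat 10 0 0 = j := by rw [f₃.nat 10 rfl, hc₂]
      have y9 : s₃.real 9 = s₂.real 9 := f₃.real 9 rfl
      simp only [NExp.eval, RExp.eval, x9, x10, h₃, State.wn_real, State.wr_real, y9, true_and]
      refine ⟨fun a ha b hb => ?_, fun b hb => ?_⟩
      · rw [if_neg (by omega)]
        exact h₂ a ha b hb
      · rcases Nat.lt_succ_iff_lt_or_eq.1 hb with hb | rfl
        · rw [if_neg (by omega)]
          exact h₂' b hb
        · simp only [if_true]
          rfl
  · rintro s' - ⟨h2, h3⟩ a ha b hb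
    rw [State.wn_real]
    rcases Nat.lt_succ_iff_lt_or_eq.1 ha with ha | rfl
    exacts [h2 a ha b hb, h3 b hb]

/-- The pair `(11, 12)` and the value of the variable `10` are the best for the pairs in `P`. -/
def BestPair (n : ℕ) (Φ : ℝ) (Vis : ℕ → Prop) (D : ℕ → ℕ → ℝ) (P : ℕ → ℕ → Prop) (s : State) :
    Prop :=
  (∀ a b, P a b → Vis a → ¬ Vis b → s.real 10 0 0 ≤ D a b) ∧
    (s.real 10 0 0 = Φ + 1 ∨ (s.nat 11 0 0 < n ∧ s.nat 12 0 0 < n ∧ Vis (s.nat 11 0 0) ∧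
      ¬ Vis (s.nat 12 0 0) ∧ s.real 10 0 0 = D (s.nat 11 0 0) (s.nat 12 0 0)))

theorem BestPair.congr {Vis : ℕ → Prop} {D : ℕ → ℕ → ℝ} {P P' : ℕ → ℕ → Prop} {s s' : State}
    (h : BestPair n Φ Vis D P s) (hP : ∀ a b, P' a b → P a b) (h1 : s'.nat 11 = s.nat 11)
    (h2 : s'.nat 12 = s.nat 12) (h3 : s'.real 10 = s.real 10) : BestPair n Φ Vis D P' s' := by
  unfold BestPair at h ⊢
  rw [h1, h2, h3]
  exact ⟨fun a b hab => h.1 a b (hP a b hab), h.2⟩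

theorem Setup.wp_closestPair (H : Setup p n d ε Φ k w l B) {s : State}
    (hs : Ready p n d ε Φ k w l s) :
    Wp closestPair (B * (B * 7 + 4) + 3) s (BestPair n Φ (fun a => 0 < s.nat 16 a 0) (s.real 9)
      (fun a b => a < n ∧ b < n)) := by
  set Vis : ℕ → Prop := fun a => 0 < s.nat 16 a 0 with hVis
  apply Wp.setReal_seq
  generalize hg : s.wr 10 (NExp.eval s (.lit 0)) (NExp.eval s (.lit 0))
    (RExp.eval s (.add phiExp (.cast (.lit 1)))) = s₀
  have h10 : s₀.real 10 0 0 = Φ + 1 := by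
    subst hg
    simp [phiExp, hs.phi]
  have hs₀ : Ready p n d ε Φ k w l s₀ := by
    subst hg
    exact hs.congr rfl rfl rfl rfl (by funext i j; simp)
  have h16 : s₀.nat 16 = s.nat 16 := by subst hg; rfl
  have h9 : s₀.real 9 = s.real 9 := by subst hg; funext i j; simp
  clear hg
  refine (Wp.forLoop (N := n) (B := B) (T := B * (5 + 2) + 2) (fun i => BestPair n Φ Vis (s.real 9)
      (fun a b => a < i ∧ b < n)) rfl (Nat.zero_le _) H.n_le
    (fun s' f => (hs₀.frame f rfl rfl rfl rfl rfl).eval_nExp) ?_ ?_).le (by ring_nf; omega)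
  · exact ⟨fun a b h => absurd h.1 (Nat.not_lt_zero a), .inl (by simpa using h10)⟩
  rintro i - hi s₁ f₁ hc₁ h₁
  have hs₁ := hs₀.frame f₁ rfl rfl rfl rfl rfl
  refine (Wp.forLoop (N := n) (T := 5) (fun j => BestPair n Φ Vis (s.real 9)
      (fun a b => a < i ∧ b < n ∨ a = i ∧ b < j)) rfl (Nat.zero_le _) H.n_le
    (fun s' f => (hs₁.frame f rfl rfl rfl rfl rfl).eval_nExp) ?_ ?_).post ?_
  · refine h₁.congr (fun a b h => ?_) (by funext i j; simp) (by funext i j; simp) rfl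
    rcases h with h | h
    · exact h
    · exact absurd h.2 (Nat.not_lt_zero b)
  · rintro j - hj s₂ f₂ hc₂ h₂
    have c₂ : s₂.nat 9 0 0 = i := by rw [f₂.nat 9 rfl, hc₁]
    have e16 : s₂.nat 16 = s.nat 16 := ((f₂.nat 16 rfl).trans (f₁.nat 16 rfl)).trans h16
    have e9 : s₂.real 9 = s.real 9 := ((f₂.real 9 rfl).trans (f₁.real 9 rfl)).trans h9
    refine Wp.ite (T := 4) (fun h => ?_) (fun h => (Wp.skip ?_).le (by norm_num))
    · simp [c₂, hc₂, e16, e9] at h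
      obtain ⟨hv1, hv2, hlt⟩ := h
      refine (Wp.setReal_seq (Wp.setNat_seq (Wp.setNat ?_))).le (T := 3) (by norm_num)
      constructor
      · intro a b hab ha hb
        simp [c₂, hc₂, e9]
        have hold : (a < i ∧ b < n ∨ a = i ∧ b < j) → s.real 9 i j ≤ s.real 9 a b :=
          fun h => hlt.le.trans (h₂.1 a b h ha hb)
        rcases hab with hab | ⟨rfl, hab⟩
        · exact hold (.inl hab)
        · rcases Nat.lt_succ_iff_lt_or_eq.1 hab with hab | rfl
          · exact hold (.inr ⟨rfl, hab⟩)
          · exact le_rfl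
      · right
        simp [c₂, hc₂, e9, hi, hj, hVis, hv1, hv2]
    · simp [c₂, hc₂, e16, e9] at h
      refine ⟨fun a b hab ha hb => ?_, by simpa using h₂.2⟩
      simp only [State.wn_real]
      rcases hab with hab | ⟨rfl, hab⟩
      · exact h₂.1 a b (.inl hab) ha hb
      · rcases Nat.lt_succ_iff_lt_or_eq.1 hab with hab | rfl
        · exact h₂.1 a b (.inr ⟨rfl, hab⟩) ha hb
        · exact h ha (by simpa [hVis] using hb)
  · intro s' f h
    refine h.congr (fun a b hab => ?_) (by funext i j; simp) (by funext i j; simp) rfl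
    rcases Nat.lt_succ_iff_lt_or_eq.1 hab.1 with ha | rfl
    · exact .inl ⟨ha, hab.2⟩
    · exact .inr ⟨rfl, hab.2⟩

theorem wp_pairLevel {s : State} {x : ℝ} (hx : s.real 10 0 0 = x) (h1 : 1 ≤ x)
    (hB : x ≤ 2 ^ B) :
    Wp pairLevel (B * 2 + 2) s (fun s' => s'.nat 13 0 0 ≤ B ∧ x ≤ 2 ^ s'.nat 13 0 0 ∧
      (2 : ℝ) ^ s'.nat 13 0 0 < 2 * x) := by
  classical
  have hex : ∃ m : ℕ, x ≤ 2 ^ m := ⟨B, hB⟩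
  have hle : Nat.find hex ≤ B := Nat.find_le hB
  refine (Wp.searchLoop_isLeast (N := Nat.find hex) (P := fun m => x ≤ 2 ^ m)
    ⟨Nat.find_spec hex, fun m hm => Nat.find_le hm⟩ (fun m => by simp [hx]) hle).post ?_
  rintro _ - rfl
  simp only [State.wn_nat, and_self, if_true]
  refine ⟨hle, Nat.find_spec hex, ?_⟩
  -- Level 0 has no predecessor to compare with; there the bound 1 ≤ x is used.
  rcases Nat.eq_zero_or_pos (Nat.find hex) with h | h
  · rw [h]; linarith
  · have := Nat.find_min hex (m := Nat.find hex - 1) (by omega)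
    rw [not_le] at this
    calc (2 : ℝ) ^ Nat.find hex = 2 ^ (Nat.find hex - 1) * 2 := by
          rw [← pow_succ]; congr 1; omega
      _ < _ := by linarith

theorem wp_blockStart {s : State} {i lv : ℕ} (hi : s.nat 8 0 0 = i) (hlv : s.nat 13 0 0 = lv)
    (hi1 : 1 ≤ i) (hB : i ≤ B) :
    Wp blockStart (B * 4 + 3) s (fun s' => s'.nat 14 0 0 < i ∧
      (s'.nat 14 0 0 = 0 ∨ lv < s.nat 18 (s'.nat 14 0 0) 0) ∧
      ∀ m, s'.nat 14 0 0 < m → m < i → s.nat 18 m 0 ≤ lv) := by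
  apply Wp.setNat_seq
  -- The index 0 is the default when no level exceeds `lv`; it stands for the root, which serves as
  -- reference for every level.
  refine (Wp.forLoop (N := i) (B := B) (T := 2) (fun t s' => (s'.nat 14 0 0 = 0 ∨
      s'.nat 14 0 0 < t ∧ lv < s.nat 18 (s'.nat 14 0 0) 0) ∧
      ∀ m, s'.nat 14 0 0 < m → m < t → s.nat 18 m 0 ≤ lv) rfl (Nat.zero_le _) hB ?_ ?_ ?_).post ?_
  · intro s' f
    have := f.nat 8 rfl
    simp [this, hi]
  · simp
  · rintro t - ht s' f hc ⟨h1, h2⟩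
    have e13 : s'.nat 13 0 0 = lv := by rw [f.nat 13 rfl]; simpa using hlv
    have e18 : s'.nat 18 = s.nat 18 := by rw [f.nat 18 rfl]; funext i j; simp
    refine Wp.ite (fun h => Wp.setNat ?_) (fun h => Wp.skip ?_)
    · simp [e13, e18, hc] at h
      simp [hc, h]
      intro m hm1 hm2
      omega
    · simp [e13, e18, hc] at h
      simp
      refine ⟨h1.imp id fun h => ⟨by omega, h.2⟩, fun m hm1 hm2 => ?_⟩
      rcases hm2.lt_or_eq with hm | rfl
      exacts [h2 m hm1 hm, h]
  · rintro s' - ⟨h1, h2⟩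
    exact ⟨by omega, h1.imp id fun h => h.2, h2⟩

/-- Here `r` is the reference and `u` the base: subtracting the approximate step from `r` to `u`
cancels the error accumulated between them. The length is at most Σ(|y_j| + k + 2) ≤ 2d + d(k + 2).
-/
theorem Setup.wp_encodeVector (H : Setup p n d ε Φ k w l B) {s : State}
    (hs : Ready p n d ε Φ k w l s) (hcnt : s.nat 4 0 0 = s.out.length) {v u lv r : ℕ}
    (hv : s.nat 12 0 0 = v) (hu : s.nat 11 0 0 = u) (hlv : s.nat 13 0 0 = lv)
    (hr : s.nat 17 (s.nat 14 0 0) 0 = r) {y : ℕ → ℝ}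
    (hy : ∀ j, y j = ((s.real 1 v j - s.real 1 r j) - (s.real 8 u j - s.real 8 r j)) *
      (d : ℝ) ^ (1 / p.toReal) / 2 ^ lv)
    (hsum : ∑ j ∈ Finset.range d, |y j| ≤ 2 * d) :
    Wp encodeVector (B * (13 * B + 24) + 3) s (fun s' => s'.nat 4 0 0 = s'.out.length ∧
      ∃ z L, z.length = d ∧ IsStream (z.map fun z => (k, z)) L ∧ s'.out = s.out ++ L ∧
        L.length ≤ d * (k + 4) ∧ (∀ j < d, |z.getD j 0 - y j| ≤ (1 / 2) ^ k) ∧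
        s'.real 8 = place ((d : ℝ) ^ (1 / p.toReal)) d (s.real 8) ⟨v, u, lv, z⟩) := by
  have hdB : d ≤ B := by have := H.d_le; omega
  have hkB : k ≤ B := by have := H.d_le; omega
  set c := (d : ℝ) ^ (1 / p.toReal) with hc
  apply Wp.setNat_seq
  refine ((Wp.forLoop (N := d) (B := B) (T := 13 * B + 22) (fun j s' =>
    s'.nat 4 0 0 = s'.out.length ∧ ∃ z L, z.length = j ∧ IsStream (z.map fun z => (k, z)) L ∧
      s'.out = s.out ++ L ∧ (L.length : ℝ) ≤ (∑ j ∈ Finset.range j, |y j|) + j * (k + 2) ∧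
      (∀ i < j, |z.getD i 0 - y i| ≤ (1 / 2) ^ k) ∧
        s'.real 8 = place c j (s.real 8) ⟨v, u, lv, z⟩)
    rfl (Nat.zero_le _) hdB ?_ ?_ ?_).le (by ring_nf; omega)).post ?_
  · intro s' f
    exact (hs.congr (s' := s') (f.nat 0 rfl) (f.nat 5 rfl) (f.nat 6 rfl) (f.nat 7 rfl)
      (f.real 0 rfl)).eval_dExp
  · refine ⟨by simpa using hcnt, [], [], rfl, rfl, by simp, by simp, by simp, ?_⟩
    funext a j
    simp [place]
  · rintro j - hj s' f hcj ⟨h0, z, L, h1, h2, h3, h4, h5, h6⟩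
    have hs' : Ready p n d ε Φ k w l s' := hs.congr (s' := s') (f.nat 0 rfl) (f.nat 5 rfl)
      (f.nat 6 rfl) (f.nat 7 rfl) (f.real 0 rfl)
    have e12 : s'.nat 12 0 0 = v := by rw [f.nat 12 rfl]; simpa using hv
    have e11 : s'.nat 11 0 0 = u := by rw [f.nat 11 rfl]; simpa using hu
    have e13 : s'.nat 13 0 0 = lv := by rw [f.nat 13 rfl]; simpa using hlv
    have e2 : s'.nat 2 0 0 = k := by rw [f.nat 2 rfl]; simpa using hs.k
    have e17 : s'.nat 17 (s'.nat 14 0 0) 0 = r := by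
      rw [f.nat 17 rfl, f.nat 14 rfl]; simpa using hr
    have e1 : s'.real 1 = s.real 1 := f.real 1 rfl
    have hX : ∀ a, s'.real 8 a j = s.real 8 a j := fun a => by rw [h6, place_apply_self]
    have hyj : |y j| ≤ 2 * d := (Finset.single_le_sum (f := fun j => |y j|)
      (fun _ _ => abs_nonneg _) (Finset.mem_range.2 hj)).trans hsum
    apply Wp.setReal_seq
    refine Wp.seqLe (T₁ := 13 * B + 20) (T₂ := 1) (by omega)
      (wp_encode (B := B) (y := y j) (K := k) ?_ (by simpa using e2) (by simpa using h0) hkB ?_) ?_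
    · simp [e12, e11, e13, e17, e1, hX, hcj, hs'.eval_dimFactor, hy, hc]
    · refine hyj.trans ?_
      have := H.d_le
      have : 2 * d ≤ B := by omega
      exact_mod_cast this
    rintro s'' f' ⟨h7, L', r', h8, h9, h10, -, h11, h12⟩
    have hs'' : Ready p n d ε Φ k w l s'' := hs'.congr (f'.nat 0 rfl) (f'.nat 5 rfl)
      (f'.nat 6 rfl) (f'.nat 7 rfl) (by rw [f'.real 0 rfl]; funext i j; simp)
    have e8 : s''.real 8 = s'.real 8 := by rw [f'.real 8 rfl]; funext i j; simp
    have g12 : s''.nat 12 0 0 = v := by rw [f'.nat 12 rfl]; simpa using e12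
    have g11 : s''.nat 11 0 0 = u := by rw [f'.nat 11 rfl]; simpa using e11
    have g13 : s''.nat 13 0 0 = lv := by rw [f'.nat 13 rfl]; simpa using e13
    have g15 : s''.nat 15 0 0 = j := by rw [f'.nat 15 rfl]; simpa using hcj
    have hget : (z ++ [r']).getD j 0 = r' := by simp [← h1]
    apply Wp.setReal
    refine ⟨by simpa using h7, z ++ [r'], L ++ L', by simp [h1], ?_, by simp [h9, h3], ?_, ?_, ?_⟩
    · rw [List.map_append]
      exact h2.snoc h8
    · rw [Finset.sum_range_succ, List.length_append]
      push_cast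
      linarith
    · intro i hi
      rcases Nat.lt_succ_iff_lt_or_eq.1 hi with hi | rfl
      · rw [List.getD_append _ _ _ _ (by omega)]
        exact h5 i hi
      · rw [hget]
        exact h11.le
    · have := place_write (s := s'') (z := z ++ [r'])
        ((e8.trans h6).trans (place_snoc h1).symm)
      rw [← this]
      simp only [NExp.eval, RExp.eval, eval_pow2, g12, g11, g13, g15, hs''.eval_dimFactor, h10,
        State.wn_real, hget, hc]
  · rintro s' - ⟨h0, z, L, h1, h2, h3, h4, h5, h6⟩
    refine ⟨h0, z, L, h1, h2, by simpa using h3, ?_, h5, h6⟩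
    have : (L.length : ℝ) ≤ ((d * (k + 4) : ℕ) : ℝ) := by
      push_cast
      linarith
    exact_mod_cast this

end

end RealRAM

/-! ### Invariant and correctness of the summary program -/

namespace RealRAM

section

variable {p : ℝ≥0∞} {n d : ℕ} {ε Φ : ℝ} {k w l B : ℕ}

/-- The number of bits reserved for one attachment. -/
def recordLength (d k w l : ℕ) : ℕ := w + w + l + 9 + d * (k + 4)

/-- The state of the summary algorithm when `i` points have been attached. -/
structure SummInv (p : ℝ≥0∞) [Fact (1 ≤ p)] (n d : ℕ) (ε Φ : ℝ) (k w l B : ℕ)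
    (F : ℕ → ℕ → ℝ) (i : ℕ) (s : State) : Prop where
  ready : Ready p n d ε Φ k w l s
  count : s.nat 4 0 0 = s.out.length
  points : s.real 1 = F
  dist : ∀ a < n, ∀ b < n, s.real 9 a b = ‖vec p d (F a - F b)‖
  marked : ∀ a, 0 < s.nat 16 a 0 ↔ ∃ m < i, s.nat 17 m 0 = a
  prim : PrimInv p d n F ((1 / 2) ^ k) i (fun m => s.nat 17 m 0) (fun m => s.nat 18 m 0) (s.real 8)
  sketch : ∃ Rs : List Attachment, Rs.length + 1 = i ∧ IsSketch n d k w l B Rs s.out ∧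
    s.real 8 = positions p d Rs
  length : s.out.length + recordLength d k w l ≤ i * recordLength d k w l

/-- The constant 64 is 8·8: error propagation loses a factor 8, and a relative error of ε/8 is to
remain. -/
theorem Setup.two_pow_k (H : Setup p n d ε Φ k w l B) : (1 / 2 : ℝ) ^ k ≤ ε / 64 := by
  have h : 64 ≤ 2 ^ k * ε := H.coord.1
  have : (0 : ℝ) < 2 ^ k := by positivity
  rw [one_div, inv_pow, inv_le_comm₀ this (by linarith [H.eps_pos]), inv_div,
    div_le_iff₀ H.eps_pos]
  exact h

theorem sum_scaled_le [Fact (1 ≤ p)] {t y : ℕ → ℝ} {lv : ℕ}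
    (ht : ‖vec p d t‖ ≤ 2 * 2 ^ lv)
    (hy : ∀ j, y j = t j * (d : ℝ) ^ (1 / p.toReal) / 2 ^ lv) :
    ∑ j ∈ Finset.range d, |y j| ≤ 2 * d := by
  have hpos : (0 : ℝ) < 2 ^ lv := by positivity
  have hc : (0 : ℝ) ≤ (d : ℝ) ^ (1 / p.toReal) := by positivity
  have h := sum_abs_mul_le_norm_toLp p (fun j : Fin d => t j)
  have h2 : ∑ j ∈ Finset.range d, |y j| =
      ((d : ℝ) ^ (1 / p.toReal) * ∑ j : Fin d, |t j|) / 2 ^ lv := by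
    rw [Finset.sum_range, Finset.mul_sum, Finset.sum_div]
    refine Finset.sum_congr rfl fun j _ => ?_
    rw [hy, abs_div, abs_mul, abs_of_nonneg hc, abs_of_pos hpos, mul_comm]
  rw [h2, div_le_iff₀ hpos]
  refine h.trans ?_
  calc (d : ℝ) * ‖vec p d t‖ ≤ d * (2 * 2 ^ lv) := by gcongr
    _ = _ := by ring

/-- The scaling by d^(1/p) before rounding cancels the factor lost in passing from coordinates to
the norm. -/
theorem Setup.norm_rounding_le [Fact (1 ≤ p)] (H : Setup p n d ε Φ k w l B) {t z y : ℕ → ℝ}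
    {lv : ℕ} (hz : ∀ j < d, |z j - y j| ≤ (1 / 2) ^ k)
    (ht : ∀ j < d, t j = (z j - y j) * 2 ^ lv / (d : ℝ) ^ (1 / p.toReal)) :
    ‖vec p d t‖ ≤ (1 / 2) ^ k * 2 ^ lv := by
  have hd : (0 : ℝ) < d := by exact_mod_cast H.one_le_d
  have hc : (0 : ℝ) < (d : ℝ) ^ (1 / p.toReal) := by positivity
  refine (norm_toLp_le_of_abs_le p (fun j : Fin d => t j)
    (c := (1 / 2) ^ k * 2 ^ lv / (d : ℝ) ^ (1 / p.toReal)) (by positivity) fun j => ?_).trans ?_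
  · rw [ht j j.2, abs_div, abs_mul, abs_of_pos hc, abs_of_pos (by positivity : (0 : ℝ) < 2 ^ lv)]
    gcongr
    exact hz j j.2
  · rw [mul_div_cancel₀ _ hc.ne']

theorem Setup.wp_attach [Fact (1 ≤ p)] (H : Setup p n d ε Φ k w l B) {F : ℕ → ℕ → ℝ}
    (hF : ∀ a < n, ∀ b < n, a ≠ b → 1 ≤ ‖vec p d (F a - F b)‖ ∧ ‖vec p d (F a - F b)‖ ≤ Φ)
    {i : ℕ} (hi1 : 1 ≤ i) (hi : i < n) {s : State} (hc : s.nat 8 0 0 = i)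
    (hI : SummInv p n d ε Φ k w l B F i s) :
    Wp attach (20 * (B * B) + 73 * B + 80) s
      (fun s' => SummInv p n d ε Φ k w l B F (i + 1) (s'.wn 8 0 0 (i + 1))) := by
  have hnB := H.n_le
  have hwB := H.w_le
  have hlB := H.l_le
  have hδ := H.two_pow_k
  have hδ2 : (1 / 2 : ℝ) ^ k ≤ 1 / 2 := by linarith [H.eps_le]
  have hδ0 : (0 : ℝ) ≤ (1 / 2) ^ k := by positivity
  have hs := hI.ready
  refine Wp.seqLe (T₁ := B * (B * 7 + 4) + 3) (T₂ := 13 * (B * B) + 69 * B + 77)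
    (by ring_nf; omega) (H.wp_closestPair hs) ?_
  rintro s₁ f₁ ⟨hmin, hbest⟩
  obtain ⟨b₀, hb₀, hb₀'⟩ := exists_lt_forall_ne (fun m => s.nat 17 m 0) hi
  have hun : ∀ b, (∀ m < i, s.nat 17 m 0 ≠ b) ↔ ¬ 0 < s.nat 16 b 0 := by
    intro b; rw [hI.marked]; push Not; rfl
  have hord := hI.prim.ord_lt
  have hle : ∀ a < i, ∀ b < n, (∀ m < i, s.nat 17 m 0 ≠ b) →
      s₁.real 10 0 0 ≤ ‖vec p d (F (s.nat 17 a 0) - F b)‖ := by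
    intro a ha b hb hb'
    rw [← hI.dist _ (hord a ha) b hb]
    exact hmin _ b ⟨hord a ha, hb⟩ ((hI.marked _).2 ⟨a, ha, rfl⟩) ((hun b).1 hb')
  have hbest : s₁.nat 11 0 0 < n ∧ s₁.nat 12 0 0 < n ∧ 0 < s.nat 16 (s₁.nat 11 0 0) 0 ∧
      ¬ 0 < s.nat 16 (s₁.nat 12 0 0) 0 ∧
      s₁.real 10 0 0 = s.real 9 (s₁.nat 11 0 0) (s₁.nat 12 0 0) := by
    -- The initial value Φ + 1 cannot survive: the unmarked point `b₀` is within Φ of the root.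
    rcases hbest with h | h
    · have h1 := hle 0 (by omega) b₀ hb₀ hb₀'
      have h2 := (hF _ (hord 0 (by omega)) b₀ hb₀ (hb₀' 0 (by omega))).2
      rw [h] at h1
      linarith
    · exact h
  clear hmin
  have hs₁ := hs.frame f₁ rfl rfl rfl rfl rfl
  generalize hu : s₁.nat 11 0 0 = u at hbest
  generalize hv : s₁.nat 12 0 0 = v at hbest
  obtain ⟨hun1, hvn, hum, hvm, h10⟩ := hbest
  obtain ⟨a, ha, hau⟩ := (hI.marked u).1 hum
  have hvm := (hun v).2 hvm
  rw [hI.dist u hun1 v hvn] at h10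
  have huv : u ≠ v := by rw [← hau]; exact hvm a ha
  have hFuv := hF u hun1 v hvn huv
  refine Wp.seqLe (T₁ := B * 2 + 2) (T₂ := 13 * (B * B) + 67 * B + 75) (by omega)
    (wp_pairLevel h10 hFuv.1 (hFuv.2.trans H.phi_le)) ?_
  rintro s₂ f₂ ⟨hlvB, hlv1, hlv2⟩
  have hs₂ := hs₁.frame f₂ rfl rfl rfl rfl rfl
  generalize hlv : s₂.nat 13 0 0 = lv at hlvB hlv1 hlv2
  have c₂ : s₂.nat 8 0 0 = i := by rw [f₂.nat 8 rfl, f₁.nat 8 rfl, hc]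
  have e18 : s₂.nat 18 = s.nat 18 := (f₂.nat 18 rfl).trans (f₁.nat 18 rfl)
  refine Wp.seqLe (T₁ := B * 4 + 3) (T₂ := 13 * (B * B) + 63 * B + 72) (by omega)
    (wp_blockStart c₂ hlv hi1 (by omega)) ?_
  rintro s₃ f₃ ⟨hri, hr0, hmax⟩
  have hs₃ := hs₂.frame f₃ rfl rfl rfl rfl rfl
  generalize hr : s₃.nat 14 0 0 = r at hri hr0 hmax
  rw [e18] at hr0 hmax
  have hv3 : s₃.nat 12 0 0 = v := by rw [f₃.nat 12 rfl, f₂.nat 12 rfl, hv]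
  have hu3 : s₃.nat 11 0 0 = u := by rw [f₃.nat 11 rfl, f₂.nat 11 rfl, hu]
  have hlv3 : s₃.nat 13 0 0 = lv := by rw [f₃.nat 13 rfl, hlv]
  have ho3 : s₃.out = s.out := by rw [f₃.out rfl, f₂.out rfl, f₁.out rfl]
  have hcnt3 : s₃.nat 4 0 0 = s₃.out.length := by
    rw [f₃.nat 4 rfl, f₂.nat 4 rfl, f₁.nat 4 rfl, ho3, hI.count]
  have hvw : ∀ x < n, x < 2 ^ w := by
    intro x hx
    have : (n : ℝ) ≤ 2 ^ w := H.label.1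
    exact hx.trans_le (by exact_mod_cast this)
  -- Minimality of the level gives 2^lv < 2Φ ≤ 2^(2^l).
  have hlvl : lv < 2 ^ l := by
    have h1 : 2 * Φ ≤ 2 ^ 2 ^ l := H.level.1
    have h2 : (2 : ℝ) ^ lv < 2 ^ 2 ^ l := by linarith [hFuv.2]
    exact (pow_lt_pow_iff_right₀ (by norm_num)).1 h2
  refine Wp.seqLe (T₁ := 13 * B + 22) (T₂ := 13 * (B * B) + 50 * B + 50) (by omega)
    (wp_encodeNat (c := 6) (v := v) (fun x => by simp [hv3]) (by decide) hs₃.w hcnt3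
      (by omega) (by omega) (hvw v hvn)) ?_
  rintro s₄ f₄ ⟨hcnt4, L₁, r₁, hL₁, hC₁, ho4, hl₁⟩
  have hs₄ := hs₃.frame f₄ rfl rfl rfl rfl rfl
  have hv4 : s₄.nat 12 0 0 = v := by rw [f₄.nat 12 rfl, hv3]
  have hu4 : s₄.nat 11 0 0 = u := by rw [f₄.nat 11 rfl, hu3]
  have hlv4 : s₄.nat 13 0 0 = lv := by rw [f₄.nat 13 rfl, hlv3]
  refine Wp.seqLe (T₁ := 13 * B + 22) (T₂ := 13 * (B * B) + 37 * B + 28) (by omega)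
    (wp_encodeNat (c := 6) (v := u) (fun x => by simp [hu4]) (by decide) hs₄.w hcnt4
      (by omega) (by omega) (hvw u hun1)) ?_
  rintro s₅ f₅ ⟨hcnt5, L₂, r₂, hL₂, hC₂, ho5, hl₂⟩
  have hs₅ := hs₄.frame f₅ rfl rfl rfl rfl rfl
  have hv5 : s₅.nat 12 0 0 = v := by rw [f₅.nat 12 rfl, hv4]
  have hu5 : s₅.nat 11 0 0 = u := by rw [f₅.nat 11 rfl, hu4]
  have hlv5 : s₅.nat 13 0 0 = lv := by rw [f₅.nat 13 rfl, hlv4]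
  refine Wp.seqLe (T₁ := 13 * B + 22) (T₂ := 13 * (B * B) + 24 * B + 6) (by omega)
    (wp_encodeNat (c := 7) (v := lv) (fun x => by simp [hlv5]) (by decide) hs₅.l hcnt5
      (by omega) (by omega) hlvl) ?_
  rintro s₆ f₆ ⟨hcnt6, L₃, r₃, hL₃, hC₃, ho6, hl₃⟩
  have hs₆ := hs₅.frame f₆ rfl rfl rfl rfl rfl
  have hv6 : s₆.nat 12 0 0 = v := by rw [f₆.nat 12 rfl, hv5]
  have hu6 : s₆.nat 11 0 0 = u := by rw [f₆.nat 11 rfl, hu5]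
  have hlv6 : s₆.nat 13 0 0 = lv := by rw [f₆.nat 13 rfl, hlv5]
  have hr6 : s₆.nat 14 0 0 = r := by rw [f₆.nat 14 rfl, f₅.nat 14 rfl, f₄.nat 14 rfl, hr]
  have g17 : s₆.nat 17 = s.nat 17 := by
    rw [f₆.nat 17 rfl, f₅.nat 17 rfl, f₄.nat 17 rfl, f₃.nat 17 rfl, f₂.nat 17 rfl, f₁.nat 17 rfl]
  have g1 : s₆.real 1 = F := by
    rw [f₆.real 1 rfl, f₅.real 1 rfl, f₄.real 1 rfl, f₃.real 1 rfl, f₂.real 1 rfl, f₁.real 1 rfl,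
      hI.points]
  have g8 : s₆.real 8 = s.real 8 := by
    rw [f₆.real 8 rfl, f₅.real 8 rfl, f₄.real 8 rfl, f₃.real 8 rfl, f₂.real 8 rfl, f₁.real 8 rfl]
  set X := s.real 8 with hX
  set ρ := s.nat 17 r 0 with hρ
  set t : ℕ → ℝ := (F v - F ρ) - (X u - X ρ) with ht
  have hnorm : ‖vec p d t‖ ≤ 2 * 2 ^ lv := by
    have := hI.prim.norm_displacement_le hδ0 hδ2 (a := a) (v := v) (l := lv) (r := r) ha hvn hvm
      (by simpa [hau] using hlv1) hri hr0 hmax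
    simpa only [hau] using this
  refine Wp.seqLe (T₁ := B * (13 * B + 24) + 3) (T₂ := 3) (by ring_nf; omega)
    (H.wp_encodeVector hs₆ hcnt6 (r := ρ) (y := fun j => t j * (d : ℝ) ^ (1 / p.toReal) / 2 ^ lv)
      hv6 hu6 hlv6 (by rw [g17, hr6]) (fun j => by simp [g1, g8, ht])
      (sum_scaled_le hnorm fun j => rfl)) ?_
  rintro s₇ f₇ ⟨hcnt7, z, L₄, hz, hL₄, ho7, hl₄, hround, hX7⟩
  have hs₇ := hs₆.frame f₇ rfl rfl rfl rfl rfl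
  have hv7 : s₇.nat 12 0 0 = v := by rw [f₇.nat 12 rfl, hv6]
  have hlv7 : s₇.nat 13 0 0 = lv := by rw [f₇.nat 13 rfl, hlv6]
  have c₇ : s₇.nat 8 0 0 = i := by
    rw [f₇.nat 8 rfl, f₆.nat 8 rfl, f₅.nat 8 rfl, f₄.nat 8 rfl, f₃.nat 8 rfl, c₂]
  have k16 : s₇.nat 16 = s.nat 16 := by
    rw [f₇.nat 16 rfl, f₆.nat 16 rfl, f₅.nat 16 rfl, f₄.nat 16 rfl, f₃.nat 16 rfl, f₂.nat 16 rfl,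
      f₁.nat 16 rfl]
  have k17 : s₇.nat 17 = s.nat 17 := by rw [f₇.nat 17 rfl, g17]
  have k18 : s₇.nat 18 = s.nat 18 := by
    rw [f₇.nat 18 rfl, f₆.nat 18 rfl, f₅.nat 18 rfl, f₄.nat 18 rfl, f₃.nat 18 rfl, e18]
  have k1 : s₇.real 1 = F := by rw [f₇.real 1 rfl, g1]
  have k9 : s₇.real 9 = s.real 9 := by
    rw [f₇.real 9 rfl, f₆.real 9 rfl, f₅.real 9 rfl, f₄.real 9 rfl, f₃.real 9 rfl, f₂.real 9 rfl,
      f₁.real 9 rfl]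
  have ho : s₇.out = s.out ++ (L₁ ++ (L₂ ++ (L₃ ++ L₄))) := by
    rw [ho7, ho6, ho5, ho4, ho3]; simp
  rw [g8] at hX7
  apply Wp.setNat_seq
  apply Wp.setNat_seq
  apply Wp.setNat
  simp only [NExp.eval, State.wn_nat, hv7, hlv7, c₇]
  norm_num
  constructor
  · exact hs₇.congr (by funext i j; simp) (by funext i j; simp) (by funext i j; simp)
      (by funext i j; simp) rfl
  · simpa using hcnt7
  · simpa using k1
  · simp only [State.wn_real, k9]
    exact hI.dist
  · intro b
    simp only [State.wn_nat]
    norm_num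
    by_cases hb : b = v
    · simp only [hb, if_true, zero_lt_one, true_iff]
      exact ⟨i, by omega, by simp⟩
    · simp only [hb, if_false, k16, hI.marked]
      constructor
      · rintro ⟨m, hm, h⟩
        exact ⟨m, by omega, by rw [if_neg (by omega), k17, h]⟩
      · rintro ⟨m, hm, h⟩
        by_cases hmi : m = i
        · rw [if_pos hmi] at h
          exact absurd h.symm hb
        · rw [if_neg hmi, k17] at h
          exact ⟨m, by omega, h⟩
  · refine hI.prim.attach (v := v) (l := lv) (r := r) (fun m hm => ?_) ?_ (fun m hm => ?_) ?_
      (fun b hb => ?_) hvn hvm (fun a ha b hb hb' => ?_) hri hr0 hmax ?_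
    · simp [hm.ne, k17]
    · simp
    · simp [hm.ne, k18]
    · simp
    · funext j
      simp [hX7, place, hb, hX]
    · have := hle a ha b hb hb'
      rw [h10] at this
      exact hlv2.trans_le (by linarith)
    -- As `X v` becomes `X u` plus the rounded `t`, the new error minus the error of the reference
    -- is exactly the rounding error of `t`.
    · refine H.norm_rounding_le hround (z := fun j => z.getD j 0) fun j hj => ?_
      have hcpos : (d : ℝ) ^ (1 / p.toReal) ≠ 0 := by
        have hd : (0 : ℝ) < d := by exact_mod_cast H.one_le_d
        positivity
      simp only [State.wn_real, hX7, Pi.sub_apply, place, hj, and_true, if_true, ht]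
      field_simp
      ring
  · obtain ⟨Rs, h1, h2, h3⟩ := hI.sketch
    refine ⟨Rs ++ [⟨v, u, lv, z⟩], by simp [h1], ?_, ?_⟩
    · simp only [State.wn_out, ho]
      exact h2.snoc ⟨L₁, L₂, L₃, L₄, r₁, r₂, r₃, rfl, ⟨hL₁, hC₁, hvn⟩, ⟨hL₂, hC₂, hun1⟩,
        ⟨hL₃, hC₃, hlvB⟩, hz, hL₄, hl₁, hl₂, hl₃, hl₄⟩
    · simp only [State.wn_real, hX7, positions, List.foldl_append, List.foldl_cons,
        List.foldl_nil]
      rw [hX, h3]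
      rfl
  · have := hI.length
    simp only [State.wn_out, ho, List.length_append, recordLength, add_mul, one_mul] at this ⊢
    omega

theorem Setup.wp_summarize [Fact (1 ≤ p)] (H : Setup p n d ε Φ k w l B) (f : Fin n → Fin d → ℝ)
    {F : ℕ → ℕ → ℝ} (hF' : F = (summInput p ε Φ f).real 1)
    (hF : ∀ a < n, ∀ b < n, a ≠ b → 1 ≤ ‖vec p d (F a - F b)‖ ∧ ‖vec p d (F a - F b)‖ ≤ Φ) :
    Wp summarize (B * (20 * (B * B) + 73 * B + 82) + B * (B * (5 * B + 13) + 4) + 6 * B + 12 +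
        n * recordLength d k w l * 3) (summInput p ε Φ f)
      (fun s' => s'.out.length = n * recordLength d k w l ∧ ∃ Rs L pad, Rs.length + 1 = n ∧
        IsSketch n d k w l B Rs L ∧ s'.out = L ++ pad ∧ ∀ x < n, ∀ y < n,
          |‖vec p d (positions p d Rs x - positions p d Rs y)‖ - ‖vec p d (F x - F y)‖| ≤
            8 * (1 / 2) ^ k * ‖vec p d (F x - F y)‖) := by
  set s := summInput p ε Φ f with hs
  have hn2 := H.two_le_n
  refine Wp.seqLe (T₁ := 6 * B + 6) (T₂ := B * (20 * (B * B) + 73 * B + 82) +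
      B * (B * (5 * B + 13) + 4) + 6 + n * recordLength d k w l * 3) (by omega)
    (H.wp_parameters (by simp [hs, summInput]) (by simp [hs, summInput])
      (by simp [hs, summInput, paramReals]) (by simp [hs, summInput, paramReals])
      (by simp [hs, summInput, paramReals])) ?_
  intro s₁ f₁ hs₁
  refine Wp.seqLe (T₁ := B * (B * (5 * B + 13) + 4) + 2) (T₂ := B * (20 * (B * B) + 73 * B + 82) +
      n * recordLength d k w l * 3 + 4) (by omega) (H.wp_distances hs₁) ?_
  intro s₂ f₂ hD
  have hs₂ := hs₁.frame f₂ rfl rfl rfl rfl rfl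
  have e1 : s₂.real 1 = F := by rw [f₂.real 1 rfl, f₁.real 1 rfl, hF']
  have e8 : s₂.real 8 = 0 := by
    rw [f₂.real 8 rfl, f₁.real 8 rfl]; funext i j; simp [hs, summInput]
  have e4 : s₂.nat 4 0 0 = 0 := by rw [f₂.nat 4 rfl, f₁.nat 4 rfl]; simp [hs, summInput]
  have eo : s₂.out = [] := by rw [f₂.out rfl, f₁.out rfl]; rfl
  have e16 : s₂.nat 16 = fun _ _ => 0 := by
    rw [f₂.nat 16 rfl, f₁.nat 16 rfl]; funext i j; simp [hs, summInput]
  have e17 : s₂.nat 17 = fun _ _ => 0 := by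
    rw [f₂.nat 17 rfl, f₁.nat 17 rfl]; funext i j; simp [hs, summInput]
  rw [f₁.real 1 rfl, ← hF'] at hD
  apply Wp.setNat_seq
  have fr : ∀ s', Frame (forLoop 8 1 nExp RealRAM.attach) (s₂.wn 16 0 0 1) s' →
      Ready p n d ε Φ k w l s' := fun s' f => hs₂.congr (f.nat 0 rfl) (f.nat 5 rfl)
        (f.nat 6 rfl) (f.nat 7 rfl) (f.real 0 rfl)
  refine Wp.seqLe (T₁ := B * ((20 * (B * B) + 73 * B + 80) + 2) + 2)
    (T₂ := n * recordLength d k w l * (2 + 1) + 1) (by ring_nf; omega)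
    (Wp.forLoop (N := n) (SummInv p n d ε Φ k w l B F) rfl (by omega) H.n_le
      (fun s' f => (fr s' f).eval_nExp) ?_
      (fun i h1 hi s' f hc hI => H.wp_attach hF h1 hi hc hI)) ?_
  · constructor
    · exact hs₂.congr (by funext i j; simp) (by funext i j; simp) (by funext i j; simp)
        (by funext i j; simp) rfl
    · simp [e4, eo]
    · simpa using e1
    · simpa using hD
    · intro a
      simp [e16, e17]
      by_cases h : a = 0
      · simp [h]
      · simp [h, Ne.symm h]
    · constructor
      · intro m hm
        simp [e17]
        omega
      · intro m hm m' hm' _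
        omega
      · intro m h1 h2
        omega
      · intro m h1 h2
        omega
    · exact ⟨[], rfl, by rw [State.wn_out, State.wn_out, eo]; exact rfl, by simpa [positions] using e8⟩
    · simp [eo]
  · intro s₃ f₃ h₃
    obtain ⟨Rs, h1, h2, h3⟩ := h₃.sketch
    have hlen := h₃.length
    set b := n * recordLength d k w l with hb
    have hholds : ∀ s', Frame (emitBit false) s₃ s' → ((BExp.rlt (.cast (nv 4))
        (.mul (.cast nExp) (.add (.cast (.add (.add (.add (nv 6) (nv 6)) (nv 7)) (.lit 9)))
          (.mul (.cast dExp) (.cast (.add (nv 5) (.lit 4))))))).holds s' ↔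
        s'.nat 4 0 0 < b) := by
      intro s' f
      have hs' := h₃.ready.frame f rfl rfl rfl rfl rfl
      simp only [BExp.holds, RExp.eval, hs'.eval_nExp, hs'.eval_dExp, NExp.eval, hs'.w, hs'.l,
        hs'.k]
      rw [← Nat.cast_lt (α := ℝ), hb, recordLength]
      push_cast
      rfl
    -- The n − 1 records use at most n − 1 of the `n` reserved blocks, so the subtraction is not
    -- truncated.
    refine ((Wp.loop (N := b - s₃.out.length) (B := b) (T := 2) (fun i s' =>
      s'.out = s₃.out ++ List.replicate i false ∧ s'.nat 4 0 0 = s'.out.length)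
      (by omega) (by simpa using h₃.count) ?_ ?_).post ?_)
    · rintro i hi s' f ⟨ho, hc⟩
      refine ⟨(hholds s' f).2 ?_, Wp.emitBit ?_⟩
      · rw [hc, ho]
        simp
        omega
      · simp [ho, hc, List.replicate_succ']
        omega
    · rintro s' f ⟨ho, hc⟩
      rw [hholds s' f, hc, ho]
      simp
      omega
    · rintro s' - ⟨-, ho, hc⟩
      refine ⟨by rw [ho]; simp; omega, Rs, s₃.out, _, h1, h2, ho, fun x hx y hy => ?_⟩
      rw [← h3]
      exact h₃.prim.abs_norm_sub_norm_le (by positivity) hx hy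

end

end RealRAM

/-! ## Metrics -/

theorem one_le_of_mem_lpMetrics {p : ℝ≥0∞} {n d : ℕ} {Φ : ℝ}
    {D : Fin n → Fin n → ℝ} (hD : D ∈ lpMetrics p n d Φ) {x y : Fin n} (hxy : x ≠ y) :
    1 ≤ D x y := by
  obtain ⟨-, h1, -⟩ := hD
  rw [← h1]
  exact ciInf_le (f := fun q : {q : Fin n × Fin n // q.1 ≠ q.2} => D q.1.1 q.1.2)
    (Set.finite_range _).bddBelow ⟨(x, y), hxy⟩

theorem le_of_mem_lpMetrics {p : ℝ≥0∞} {n d : ℕ} {Φ : ℝ}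
    {D : Fin n → Fin n → ℝ} (hD : D ∈ lpMetrics p n d Φ) (x y : Fin n) : D x y ≤ Φ := by
  obtain ⟨-, h1, h2⟩ := hD
  rw [spread, h1, div_one] at h2
  exact (le_ciSup (f := fun q : Fin n × Fin n => D q.1 q.2) (Set.finite_range _).bddAbove
    (x, y)).trans h2

/-! ### Distortion and running time -/

namespace RealRAM

section

variable {p : ℝ≥0∞} {n d : ℕ} {ε Φ : ℝ} {k w l B : ℕ}

theorem Setup.isSketchingScheme (H : Setup p n d ε Φ k w l B) {T : ℝ} (hT : 500 * (B : ℝ) ^ 3 ≤ T) :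
    IsSketchingScheme summarize estimate p n d ε Φ (n * recordLength d k w l) T := by
  have : Fact (1 ≤ p) := ⟨H.one_le_p⟩
  intro D hD f hf
  have hB1 : 1 ≤ B := by have := H.w_le; omega
  have hB2 : B ≤ B ^ 3 := Nat.le_self_pow (by norm_num) B
  have hB3 : B ^ 2 ≤ B ^ 3 := Nat.pow_le_pow_right hB1 (by norm_num)
  have hB4 : 1 ≤ B ^ 3 := Nat.one_le_pow _ _ hB1
  set F := (summInput p ε Φ f).real 1 with hF
  have hFf : ∀ x : Fin n, ∀ j : Fin d, F x j = f x j := by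
    intro x j
    simp [hF, summInput]
  have hdist : ∀ x y : Fin n, D x y = ‖vec p d (F x - F y)‖ := by
    intro x y
    rw [hf x y]
    congr 2
    funext j
    simp [hFf]
  have hF1 : ∀ a < n, ∀ b < n, a ≠ b →
      1 ≤ ‖vec p d (F a - F b)‖ ∧ ‖vec p d (F a - F b)‖ ≤ Φ := by
    intro a ha b hb hab
    rw [← hdist ⟨a, ha⟩ ⟨b, hb⟩]
    exact ⟨one_le_of_mem_lpMetrics hD (by simpa using hab), le_of_mem_lpMetrics hD _ _⟩
  obtain ⟨s', t, he, ht, hlen, Rs, L, pad, hRs, hL, hout, herr⟩ := H.wp_summarize f hF hF1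
  -- A record length is (w + 3) + (w + 3) + (l + 3) + d(k + 4), four summands of at most `B`.
  have hrec : n * recordLength d k w l ≤ B * (4 * B) := by
    have := H.w_le
    have := H.l_le
    have := H.coord_le
    exact Nat.mul_le_mul H.n_le (by rw [recordLength]; omega)
  refine ⟨s'.out, hlen, ⟨s', t, he, ?_, rfl⟩, fun x y => ?_⟩
  · refine le_trans ?_ hT
    have : t ≤ 500 * B ^ 3 := by
      refine ht.trans ?_
      ring_nf at hrec hB2 hB3 hB4 ⊢
      omega
    exact_mod_cast this
  · obtain ⟨s'', t', he', ht', hr⟩ := H.wp_estimate (x := x) (y := y) hRs hL hout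
    refine ⟨_, ⟨s'', t', he', ?_, rfl⟩, ?_⟩
    · refine le_trans ?_ hT
      have : t' ≤ 500 * B ^ 3 := by
        refine ht'.trans ?_
        ring_nf at hB2 hB3 hB4 ⊢
        omega
      exact_mod_cast this
    · have h1 := abs_le.1 (herr x x.2 y y.2)
      rw [hr, hdist]
      have hδ := H.two_pow_k
      have hε := H.eps_pos
      have hε2 := H.eps_le
      have hnn := norm_nonneg (vec p d (F x - F y))
      set N := ‖vec p d (F x - F y)‖
      set M := ‖vec p d (positions p d Rs x - positions p d Rs y)‖
      have h2 : 8 * (1 / 2) ^ k * N ≤ ε / 8 * N := by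
        apply mul_le_mul_of_nonneg_right _ hnn
        linarith
      have h3 : (1 - ε / 8) * N ≤ M := by linarith [h1.1]
      have h4 : M ≤ (1 + ε / 8) * N := by linarith [h1.2]
      -- Both bounds are elementary for ε ≤ 1/2: (1 − ε/8)(1 + ε/4) ≥ 1 and (1 + ε/8)(1 + ε/4) ≤ 1 +
      -- ε.
      constructor
      · calc N ≤ (1 - ε / 8) * (1 + ε / 4) * N := by
              apply le_mul_of_one_le_left hnn
              nlinarith
          _ = (1 - ε / 8) * N * (1 + ε / 4) := by ring
          _ ≤ M * (1 + ε / 4) := by gcongr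
      · calc M * (1 + ε / 4) ≤ (1 + ε / 8) * N * (1 + ε / 4) := by gcongr
          _ = (1 + ε / 8) * (1 + ε / 4) * N := by ring
          _ ≤ (1 + ε) * N := by
              gcongr
              nlinarith

end

/-- Failure at the predecessor is what bounds the digit counts `k`, `w`, `l` from above. -/
theorem exists_isLeast_and_pred {P : ℕ → Prop} (h : ∃ m, P m) :
    ∃ m, IsLeast {m | P m} m ∧ (m = 0 ∨ ¬ P (m - 1)) := by
  classical
  refine ⟨Nat.find h, ⟨Nat.find_spec h, fun m hm => Nat.find_le hm⟩, ?_⟩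
  rcases Nat.eq_zero_or_pos (Nat.find h) with h0 | h0
  · exact .inl h0
  · exact .inr (Nat.find_min h (by omega))

end RealRAM

/-! ### Bit count and choice of the parameters -/

open RealRAM in
theorem theorem1 :
    ∃ (Summ Est : RealRAM.Cmd) (C : ℝ) (K k : ℕ),
      ∀ (p : ℝ≥0∞) (n d : ℕ) (ε Φ : ℝ),
        1 ≤ p → 2 ≤ n → 1 ≤ d → 0 < ε → ε ≤ 1 / 2 → 2 ≤ Φ →
        ∃ b : ℕ, 0 < b ∧
          (b : ℝ) ≤ C * ((n : ℝ) * ((d : ℝ) + Real.logb 2 n) * Real.logb 2 (1 / ε)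
            + (n : ℝ) * Real.logb 2 (Real.logb 2 Φ)) ∧
          IsSketchingScheme Summ Est p n d ε Φ b
            ((K : ℝ) * ((n : ℝ) + (d : ℝ) + 1 / ε + Real.logb 2 Φ) ^ k) := by
  -- The time bound is 500·B³ with B ≤ 1000·Q², where `Q` is the sum of the size parameters; hence
  -- the degree 6.
  refine ⟨summarize, estimate, 25, 500 * 1000 ^ 3, 6, ?_⟩
  intro p n d ε Φ hp hn hd hε hε2 hΦ
  have hn' : (2 : ℝ) ≤ n := by exact_mod_cast hn
  have hd' : (1 : ℝ) ≤ d := by exact_mod_cast hd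
  have hε3 : 2 ≤ 1 / ε := by rw [le_div_iff₀ hε]; linarith
  set E := Real.logb 2 (1 / ε) with hE
  set ν := Real.logb 2 n with hν
  set Λ := Real.logb 2 Φ with hΛ
  set lam := Real.logb 2 Λ with hlam
  have two_pow : ∀ (m : ℕ) (x : ℝ), 0 < x → (2 : ℝ) ^ m ≤ x → (m : ℝ) ≤ Real.logb 2 x := by
    intro m x hx h
    rw [Real.le_logb_iff_rpow_le (by norm_num) hx]
    simpa using h
  have hE1 : 1 ≤ E := by simpa using two_pow 1 _ (by linarith) (by simpa using hε3)
  have hν1 : 1 ≤ ν := by simpa using two_pow 1 _ (by linarith) (by simpa using hn')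
  have hΛ1 : 1 ≤ Λ := by simpa using two_pow 1 _ (by linarith) (by simpa using hΦ)
  have hlam0 : 0 ≤ lam := by simpa using two_pow 0 _ (by linarith) (by simpa using hΛ1)
  have hΦΛ : Φ = 2 ^ Λ := (Real.rpow_logb (by norm_num) (by norm_num) (by linarith)).symm
  obtain ⟨k, hk, hk'⟩ := exists_isLeast_and_pred (P := fun m : ℕ => 64 ≤ 2 ^ m * ε) (by
    obtain ⟨m, hm⟩ := pow_unbounded_of_one_lt (64 / ε) (one_lt_two)
    exact ⟨m, by rw [div_lt_iff₀ hε] at hm; exact hm.le⟩)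
  obtain ⟨w, hw, hw'⟩ := exists_isLeast_and_pred (P := fun m : ℕ => (n : ℝ) ≤ 2 ^ m) (by
    obtain ⟨m, hm⟩ := pow_unbounded_of_one_lt (n : ℝ) (one_lt_two)
    exact ⟨m, hm.le⟩)
  obtain ⟨l, hl, hl'⟩ := exists_isLeast_and_pred (P := fun m : ℕ => 2 * Φ ≤ 2 ^ 2 ^ m) (by
    obtain ⟨m, hm⟩ := pow_unbounded_of_one_lt (2 * Φ) (one_lt_two)
    exact ⟨m, hm.le.trans (pow_le_pow_right₀ (by norm_num) Nat.lt_two_pow_self.le)⟩)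
  have half : ∀ m : ℕ, m ≠ 0 → (2 : ℝ) ^ m = 2 * 2 ^ (m - 1) := by
    intro m hm
    rw [← pow_succ']
    congr 1
    omega
  have hkpow : (2 : ℝ) ^ k ≤ 128 * (1 / ε) := by
    rcases eq_or_ne k 0 with rfl | h0
    · simp; simp at hε3; linarith
    · have h := hk'.resolve_left h0
      rw [not_le] at h
      rw [half k h0, mul_one_div, le_div_iff₀ hε]
      linarith
  have hwpow : (2 : ℝ) ^ w ≤ 2 * n := by
    rcases eq_or_ne w 0 with rfl | h0
    · simp; linarith
    · have h := hw'.resolve_left h0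
      rw [not_le] at h
      rw [half w h0]
      linarith
  have hlpow : (2 : ℝ) ^ l ≤ 4 * Λ := by
    rcases eq_or_ne l 0 with rfl | h0
    · simp; linarith
    · have h := hl'.resolve_left h0
      rw [not_le] at h
      have h2 : ((2 ^ (l - 1) : ℕ) : ℝ) ≤ Real.logb 2 (2 * Φ) := two_pow _ _ (by linarith) h.le
      rw [Real.logb_mul (by norm_num) (by linarith), Real.logb_self_eq_one (by norm_num)] at h2
      push_cast at h2
      rw [half l h0]
      linarith
  have hkE : (k : ℝ) ≤ 7 + E := by
    have h := two_pow k _ (by positivity) hkpow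
    rw [Real.logb_mul (by norm_num) (by positivity)] at h
    have h7 : Real.logb 2 128 = 7 := by
      rw [show (128 : ℝ) = 2 ^ (7 : ℝ) by norm_num, Real.logb_rpow (by norm_num) (by norm_num)]
    linarith
  have hwν : (w : ℝ) ≤ 1 + ν := by
    have h := two_pow w _ (by positivity) hwpow
    rwa [Real.logb_mul (by norm_num) (by positivity), Real.logb_self_eq_one (by norm_num)] at h
  have hll : (l : ℝ) ≤ 2 + lam := by
    have h := two_pow l _ (by positivity) hlpow
    rw [Real.logb_mul (by norm_num) (by positivity)] at h
    have h4 : Real.logb 2 4 = 2 := by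
      rw [show (4 : ℝ) = 2 ^ (2 : ℝ) by norm_num, Real.logb_rpow (by norm_num) (by norm_num)]
    linarith
  have hself : ∀ m : ℕ, (m : ℝ) ≤ 2 ^ m := fun m => by exact_mod_cast Nat.lt_two_pow_self.le
  refine ⟨n * recordLength d k w l, Nat.mul_pos (by omega) (by rw [recordLength]; omega), ?_, ?_⟩
  -- The record length is at most 13 + 2ν + lam + 11d + dE. As `d` and `E` are at least 1, the terms
  -- 13, 11d and dE together are at most 25dE.
  · have hrec : (recordLength d k w l : ℝ) ≤ 25 * ((d + ν) * E + lam) := by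
      rw [recordLength]
      push_cast
      have h1 : (d : ℝ) * (k + 4) ≤ d * (11 + E) :=
        mul_le_mul_of_nonneg_left (by linarith) (by positivity)
      have h2 : (d : ℝ) * 1 ≤ d * E := by gcongr
      have h3 : ν * 1 ≤ ν * E := by gcongr
      nlinarith
    push_cast
    calc (n : ℝ) * recordLength d k w l ≤ n * (25 * ((d + ν) * E + lam)) := by gcongr
      _ = _ := by ring
  -- One summand for each inequality of `Setup` that involves `B`; the last one gives Φ = 2^Λ ≤ 2^B.
  · set B := n + (2 * d + k + 3) + d * (k + 4) + (w + 3) + (l + 3) + ⌈Λ⌉₊ with hB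
    have H : Setup p n d ε Φ k w l B := by
      refine ⟨hp, hn, hd, hε, hε2, hΦ, hk, hw, hl, by omega, by omega, by omega, by omega,
        by omega, ?_⟩
      rw [hΦΛ, ← Real.rpow_natCast]
      apply Real.rpow_le_rpow_of_exponent_le (by norm_num)
      exact (Nat.le_ceil Λ).trans (by exact_mod_cast (by omega : ⌈Λ⌉₊ ≤ B))
    apply H.isSketchingScheme
    set Q := (n : ℝ) + d + 1 / ε + Λ with hQ
    have hceil : (⌈Λ⌉₊ : ℝ) ≤ Λ + 1 := (Nat.ceil_lt_add_one (by linarith)).le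
    -- The crude bound k ≤ 2^k ≤ 128/ε suffices here; the square comes from the product d(k + 4).
    have hBQ : (B : ℝ) ≤ 1000 * Q ^ 2 := by
      have hk2 := (hself k).trans hkpow
      have hw2 := (hself w).trans hwpow
      have hl2 := (hself l).trans hlpow
      rw [hB]
      push_cast
      have hkQ : (k : ℝ) ≤ 128 * Q := by linarith
      have hdQ : (d : ℝ) ≤ Q := by linarith
      have hQ1 : 1 ≤ Q := by linarith
      have h1 : (d : ℝ) * (k + 4) ≤ Q * (128 * Q + 4) := by gcongr
      have h2 : Q ≤ Q ^ 2 := by nlinarith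
      nlinarith
    calc 500 * (B : ℝ) ^ 3 ≤ 500 * (1000 * Q ^ 2) ^ 3 := by gcongr
      _ = _ := by push_cast; ring
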